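/- **Setting.** Let $(X,\omega)$ be a finite-dimensional smooth symplectic manifold (Hausdorff, $\sigma$-compact, without boundary) and let $i:Y\hookrightarrow X$ be an embedded coisotropic submanifold, i.e. $(TY)^\omega\subseteq TY$. Write $T\mathcal F=(TY)^\omega=\ker(i^*\omega)\subseteq TY$ for the (involutive, constant rank) tangent distribution of the null foliation $\mathcal F$ of $Y$. Let $\Omega^0(\mathcal F)=C^\infty(Y)$ and $\Omega^1(\mathcal F)=\Gamma(T^*\mathcal F)$, and let $d_{\mathcal F}$ be the exterior derivative along the leaves: $$d_{\mathcal F}f=df|_{T\mathcal F},\qquad (d_{\mathcal F}\xi)(\sigma,\tau)=\sigma(\xi(\tau))-\tau(\xi(\sigma))-\xi([\sigma,\tau])\quad(\sigma,\tau\in\Gamma(T\mathcal F)).$$ Let $H^1(\mathcal F)=\ker d_{\mathcal F}|_{\Omega^1(\mathcal F)}\,/\,\operatorname{im} d_{\mathcal F}|_{\Omega^0(\mathcal F)}$. Identify the normal bundle $NY=TX|_Y/TY$ with $T^*\mathcal F$ by $[V]\mapsto\omega(V,\cdot)|_{T\mathcal F}$. * A *deformation* of $Y$ is a family of maps $\varphi_t:Y\to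 X$ with $\varphi_0=i$ such that $(t,y)\mapsto\varphi_t(y)$ is smooth on an open neighbourhood of $\{0\}\times Y$ in $\mathbb R\times Y$. Its *normal velocity* is the section of $T^*\mathcal F\cong NY$ given by $\partial_t\varphi_t|_{t=0}$. * A deformation is *coisotropic to first order* if for every $y\in Y$, with $W_t=d\varphi_t(T_yY)\subseteq T_{\varphi_t(y)}X$, one has $\frac{d}{dt}\big|_{t=0}\omega(u_t,v_t)=0$ for all vector fields $u_t,v_t$ along the curve $t\mapsto\varphi_t(y)$ that are differentiable at $t=0$ and satisfy $u_t,v_t\in W_t^\omega$ for all small $t$. (This is the linearization of the coisotropy condition, which says that $\omega$ vanishes on $W_t^\omega$.) * A section $\xi\in\Omega^1(\mathcal F)$ is an *infinitesimal deformation* of the coisotropic submanifold $Y$ if it is the normal velocity of a deformation of $Y$ that is coisotropic to first order. * A section $\xi\in\Omega^1(\mathcal F)$ is an *infinitesimal Hamiltonian deformation* of $Y$ if it is the normal part $\omega(Z,\cdot)|_{T\mathcal F}$ along $Y$ of the Hamiltonian vector field $Z$ (with $\omega(Z,\cdot)=dh$) of a smooth function $h$ on an open neighbourhood of $Y$ in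 $X$. **Theorem.** 1. A section $\xi\in\Omega^1(\mathcal F)$ is an infinitesimal deformation of the coisotropic submanifold $Y$ if and only if $d_{\mathcal F}\xi=0$. 2. More precisely, any deformation of $Y$ with normal velocity $\xi\in\Omega^1(\mathcal F)$ is coisotropic to first order if and only if $d_{\mathcal F}\xi=0$. 3. A section $\xi\in\Omega^1(\mathcal F)$ is an infinitesimal Hamiltonian deformation of $Y$ if and only if $\xi=d_{\mathcal F}f$ for some $f\in C^\infty(Y)$. 4. Consequently the infinitesimal deformations form a linear subspace $D\subseteq\Omega^1(\mathcal F)$, the infinitesimal Hamiltonian deformations form a linear subspace $T\subseteq D$, and $[\xi]\mapsto[\xi]$ is a linear isomorphism $D/T\cong H^1(\mathcal F)$. -/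

import Mathlib

open scoped Manifold ContDiff Topology
open Set Filter

/-! ### Symplectic manifolds -/

/-- The expression of a field of `2`-forms on the manifold `X` in the chart around `x₀`: its
pullback under the inverse of the chart, a differential form on (a part of) the model space. -/
noncomputable def twoFormInChart {E : Type*} [NormedAddCommGroup E] [NormedSpace ℝ E]
    {X : Type*} [TopologicalSpace X] [ChartedSpace E X]
    (Ω : ∀ x : X, TangentSpace 𝓘(ℝ, E) x [⋀^Fin 2]→L[ℝ] ℝ) (x₀ : X) (e : E) :
    E [⋀^Fin 2]→L[ℝ] ℝ :=
  (Ω ((extChartAt 𝓘(ℝ, E) x₀).symm e)).compContinuousLinearMap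
    (mfderiv 𝓘(ℝ, E) 𝓘(ℝ, E) (extChartAt 𝓘(ℝ, E) x₀).symm e)

/-- A symplectic form on the manifold `X`: a smooth, closed, nondegenerate field of `2`-forms. -/
structure SymplecticForm (E : Type*) [NormedAddCommGroup E] [NormedSpace ℝ E]
    (X : Type*) [TopologicalSpace X] [ChartedSpace E X] where
  /-- the underlying field of alternating bilinear forms on the tangent spaces -/
  form : ∀ x : X, TangentSpace 𝓘(ℝ, E) x [⋀^Fin 2]→L[ℝ] ℝ
  smooth : ∀ x₀ : X,
    ContDiffOn ℝ ∞ (twoFormInChart form x₀) (extChartAt 𝓘(ℝ, E) x₀).target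
  closed : ∀ x₀ : X, ∀ e ∈ (extChartAt 𝓘(ℝ, E) x₀).target,
    extDeriv (twoFormInChart form x₀) e = 0
  nondegenerate : ∀ (x : X) (v : TangentSpace 𝓘(ℝ, E) x),
    (∀ w : TangentSpace 𝓘(ℝ, E) x, form x ![v, w] = 0) → v = 0

namespace SymplecticForm

variable {E : Type*} [NormedAddCommGroup E] [NormedSpace ℝ E]
  {X : Type*} [TopologicalSpace X] [ChartedSpace E X]

/-- The symplectic orthogonal `W^ω` of a subspace `W` of a tangent space. -/
def orthogonal (Ω : SymplecticForm E X) {x : X} (W : Submodule ℝ (TangentSpace 𝓘(ℝ, E) x)) :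
    Submodule ℝ (TangentSpace 𝓘(ℝ, E) x) where
  carrier := {v | ∀ w ∈ W, Ω.form x ![v, w] = 0}
  zero_mem' _ _ := (Ω.form x).map_coord_zero 0 rfl
  add_mem' {a b} ha hb w hw := by
    have h : Ω.form x ![a + b, w] = Ω.form x ![a, w] + Ω.form x ![b, w] :=
      (Ω.form x).toAlternatingMap.map_vecCons_add ![w] a b
    rw [h, ha w hw, hb w hw, add_zero]
  smul_mem' c a ha w hw := by
    have h : Ω.form x ![c • a, w] = c • Ω.form x ![a, w] :=
      (Ω.form x).toAlternatingMap.map_vecCons_smul ![w] c a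
    rw [h, ha w hw, smul_zero]

end SymplecticForm

open VectorField in
/-- If two vector fields lie in the kernel of a closed `2`-form, so does their Lie bracket. -/
theorem lieBracket_kernel {F : Type*} [NormedAddCommGroup F] [NormedSpace ℝ F]
    {η : F → F [⋀^Fin 2]→L[ℝ] ℝ} {A B : F → F} {e₀ : F} (hη : DifferentiableAt ℝ η e₀)
    (hclosed : extDeriv η e₀ = 0) (hA : DifferentiableAt ℝ A e₀) (hB : DifferentiableAt ℝ B e₀)
    (hA0 : ∀ᶠ e in 𝓝 e₀, ∀ b : F, η e ![A e, b] = 0)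
    (hB0 : ∀ᶠ e in 𝓝 e₀, ∀ b : F, η e ![B e, b] = 0) (c : F) :
    η e₀ ![lieBracket ℝ A B e₀, c] = 0 := by
  have hswap : ∀ e a b, η e ![a, b] = 0 → η e ![b, a] = 0 := by
    intro e a b hab
    have h := (η e).toAlternatingMap.map_swap ![a, b] (i := 0) (j := 1) (by simp)
    have h2 : (![a, b] : Fin 2 → F) ∘ Equiv.swap 0 1 = ![b, a] := by
      funext i; fin_cases i <;> simp
    rw [h2] at h
    have h3 : η e ![b, a] = - η e ![a, b] := h
    rw [h3, hab, neg_zero]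
  have h := extDeriv_apply_vectorField (V := ![A, B, fun _ => c]) hη
    (by intro i; fin_cases i <;> simp [hA, hB])
  have hV : ∀ e, (fun i : Fin 3 => (![A, B, fun _ => c] : Fin 3 → F → F) i e) = ![A e, B e, c] := by
    intro e; funext i; fin_cases i <;> rfl
  have d1 : fderiv ℝ (fun e => η e ![B e, c]) e₀ = 0 := by
    rw [Filter.EventuallyEq.fderiv_eq (f := fun _ => (0 : ℝ)) (hB0.mono fun e he => he c)]
    simp
  have d2 : fderiv ℝ (fun e => η e ![A e, c]) e₀ = 0 := by
    rw [Filter.EventuallyEq.fderiv_eq (f := fun _ => (0 : ℝ)) (hA0.mono fun e he => he c)]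
    simp
  have d3 : fderiv ℝ (fun e => η e ![A e, B e]) e₀ = 0 := by
    rw [Filter.EventuallyEq.fderiv_eq (f := fun _ => (0 : ℝ)) (hA0.mono fun e he => he (B e))]
    simp
  have e1 : ∀ u, η e₀ ![u, A e₀] = 0 := fun u => hswap _ _ _ (hA0.self_of_nhds u)
  have e2 : ∀ u, η e₀ ![u, B e₀] = 0 := fun u => hswap _ _ _ (hB0.self_of_nhds u)
  rw [hclosed] at h
  have s3 : ∀ f : Fin (1 + 2) → ℝ, ∑ i, f i = f 0 + f 1 + f 2 := fun f => Fin.sum_univ_three f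
  have s2 : ∀ f : Fin (1 + 1) → ℝ, ∑ i, f i = f 0 + f 1 := fun f => Fin.sum_univ_two f
  have s0 : ∀ f : Fin (1 + 1) → ℝ, ∑ i ∈ Finset.Ici 0, f i = f 0 + f 1 := fun f => by
    rw [show Finset.Ici (0 : Fin (1 + 1)) = {0, 1} by decide, Finset.sum_pair (by decide)]
  have s1 : ∀ f : Fin (1 + 1) → ℝ, ∑ i ∈ Finset.Ici 1, f i = f 1 := fun f => by
    rw [show Finset.Ici (1 : Fin (1 + 1)) = {1} by decide, Finset.sum_singleton]
  have r0 : ∀ a b c : F, Fin.removeNth (0 : Fin (1 + 2)) ![a, b, c] = ![b, c] := by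
    intro a b c; funext i; fin_cases i <;> rfl
  have r1 : ∀ a b c : F, Fin.removeNth (1 : Fin (1 + 2)) ![a, b, c] = ![a, c] := by
    intro a b c; funext i; fin_cases i <;> rfl
  have r2 : ∀ a b c : F, Fin.removeNth (2 : Fin (1 + 2)) ![a, b, c] = ![a, b] := by
    intro a b c; funext i; fin_cases i <;> rfl
  have t0 : ∀ a b : F, Fin.removeNth (0 : Fin (1 + 1)) ![a, b] = ![b] := by
    intro a b; funext i; fin_cases i; rfl
  have t1 : ∀ a b : F, Fin.removeNth (1 : Fin (1 + 1)) ![a, b] = ![a] := by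
    intro a b; funext i; fin_cases i; rfl
  have c0 : Fin.castSucc (0 : Fin (1 + 1)) = 0 := rfl
  have c1 : Fin.castSucc (1 : Fin (1 + 1)) = 1 := rfl
  simp only [hV, s3, s2, s0, s1, c0, c1, r0, r1, r2, t0, t1, d1, d2, d3, e1, e2] at h
  have u0 : Fin.succ (0 : Fin (1 + 1)) = 1 := rfl
  simpa [u0] using h.symm

/-! ### Coisotropic submanifolds and their null foliation -/

/-- A coisotropic submanifold of the symplectic manifold `(X, Ω)`: an embedded submanifold
`i : Y ↪ X` with `(TY)^ω ⊆ TY`. (The rank of `(TY)^ω` is `dim X - dim Y`, hence constant.) -/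
structure CoisotropicSubmanifold {E : Type*} [NormedAddCommGroup E] [NormedSpace ℝ E]
    {X : Type*} [TopologicalSpace X] [ChartedSpace E X] (Ω : SymplecticForm E X)
    (F : Type*) [NormedAddCommGroup F] [NormedSpace ℝ F]
    (Y : Type*) [TopologicalSpace Y] [ChartedSpace F Y] where
  /-- the inclusion of the submanifold -/
  incl : Y → X
  isSmoothEmbedding : Manifold.IsSmoothEmbedding 𝓘(ℝ, F) 𝓘(ℝ, E) ∞ incl
  coisotropic : ∀ y : Y,
    Ω.orthogonal (LinearMap.range (mfderiv 𝓘(ℝ, F) 𝓘(ℝ, E) incl y).toLinearMap) ≤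
      LinearMap.range (mfderiv 𝓘(ℝ, F) 𝓘(ℝ, E) incl y).toLinearMap

namespace CoisotropicSubmanifold

section NullFoliation

variable {E : Type*} [NormedAddCommGroup E] [NormedSpace ℝ E]
  {X : Type*} [TopologicalSpace X] [ChartedSpace E X] {Ω : SymplecticForm E X}
  {F : Type*} [NormedAddCommGroup F] [NormedSpace ℝ F]
  {Y : Type*} [TopologicalSpace Y] [ChartedSpace F Y]

/-- The fibre at `y` of the characteristic distribution `T𝓕 = (TY)^ω ⊆ TY`, the tangent
distribution of the null foliation `𝓕` of `Y`. -/
noncomputable def nullDistribution (S : CoisotropicSubmanifold Ω F Y) (y : Y) :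
    Submodule ℝ (TangentSpace 𝓘(ℝ, F) y) :=
  (Ω.orthogonal (LinearMap.range (mfderiv 𝓘(ℝ, F) 𝓘(ℝ, E) S.incl y).toLinearMap)).comap
    (mfderiv 𝓘(ℝ, F) 𝓘(ℝ, E) S.incl y).toLinearMap

/-- A tangent vector lies in `T𝓕` iff it is in the kernel of the pull-back of the symplectic
form. -/
theorem mem_nullDistribution (S : CoisotropicSubmanifold Ω F Y) (y : Y)
    (v : TangentSpace 𝓘(ℝ, F) y) :
    v ∈ S.nullDistribution y ↔ ∀ w : TangentSpace 𝓘(ℝ, F) y,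
      Ω.form (S.incl y) ![mfderiv 𝓘(ℝ, F) 𝓘(ℝ, E) S.incl y v,
        mfderiv 𝓘(ℝ, F) 𝓘(ℝ, E) S.incl y w] = 0 := by
  constructor
  · intro h w
    exact h _ ⟨w, rfl⟩
  · rintro h _ ⟨w, rfl⟩
    exact h w

variable [IsManifold 𝓘(ℝ, F) ∞ Y]

/-- The smooth vector fields on `Y` tangent to the null foliation, i.e. the smooth sections
of `T𝓕`. -/
structure LeafwiseVectorField (S : CoisotropicSubmanifold Ω F Y) where
  /-- the underlying vector field -/
  field : ∀ y : Y, TangentSpace 𝓘(ℝ, F) y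
  smooth : ContMDiff 𝓘(ℝ, F) 𝓘(ℝ, F).tangent ∞
    (fun y => (⟨y, field y⟩ : TangentBundle 𝓘(ℝ, F) Y))
  mem : ∀ y, field y ∈ S.nullDistribution y

variable [IsManifold 𝓘(ℝ, E) ∞ X] [FiniteDimensional ℝ F]

open VectorField in
/-- The distribution `T𝓕` is involutive, because the symplectic form is closed. -/
theorem mlieBracket_mem (S : CoisotropicSubmanifold Ω F Y) (σ τ : S.LeafwiseVectorField) (y : Y) :
    mlieBracket 𝓘(ℝ, F) σ.field τ.field y ∈ S.nullDistribution y := by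
  rw [S.mem_nullDistribution]
  intro w
  set φ : F → Y := ⇑(extChartAt 𝓘(ℝ, F) y).symm with hφ
  set e₀ : F := extChartAt 𝓘(ℝ, F) y y with he₀
  set ψ := extChartAt 𝓘(ℝ, E) (S.incl y) with hψ
  set g : F → E := fun e => ψ (S.incl (φ e)) with hg
  have hi : ContMDiff 𝓘(ℝ, F) 𝓘(ℝ, E) ∞ S.incl := S.isSmoothEmbedding.contMDiff
  have hφe₀ : φ e₀ = y := extChartAt_to_inv y
  have htgt : (extChartAt 𝓘(ℝ, F) y).target ∈ 𝓝 e₀ := extChartAt_target_mem_nhds y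
  have hφs : ContMDiffOn 𝓘(ℝ, F) 𝓘(ℝ, F) ∞ φ (extChartAt 𝓘(ℝ, F) y).target :=
    contMDiffOn_extChartAt_symm y
  have hopen : IsOpen (extChartAt 𝓘(ℝ, F) y).target := isOpen_extChartAt_target y
  have hφat : ∀ e ∈ (extChartAt 𝓘(ℝ, F) y).target, ContMDiffAt 𝓘(ℝ, F) 𝓘(ℝ, F) ∞ φ e :=
    fun e he => (hφs e he).contMDiffAt (hopen.mem_nhds he)
  have hsrc : ∀ᶠ e in 𝓝 e₀, S.incl (φ e) ∈ ψ.source := by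
    have hc : ContinuousAt (fun e => S.incl (φ e)) e₀ :=
      (hi.continuous.continuousAt).comp (hφat e₀ (mem_of_mem_nhds htgt)).continuousAt
    refine hc.eventually_mem ?_
    rw [hφe₀]
    exact extChartAt_source_mem_nhds (S.incl y)
  have hev : ∀ᶠ e in 𝓝 e₀, e ∈ (extChartAt 𝓘(ℝ, F) y).target ∧ S.incl (φ e) ∈ ψ.source :=
    Filter.Eventually.and htgt hsrc
  have hev₀ := hev.self_of_nhds
  have hgs : ∀ e, e ∈ (extChartAt 𝓘(ℝ, F) y).target → S.incl (φ e) ∈ ψ.source →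
      ContDiffAt ℝ ∞ g e := by
    intro e he hs
    have h1 : ContMDiffAt 𝓘(ℝ, F) 𝓘(ℝ, E) ∞ (fun e => S.incl (φ e)) e :=
      (hi.contMDiffAt).comp e (hφat e he)
    have h2 : ContMDiffAt 𝓘(ℝ, E) 𝓘(ℝ, E) ∞ ψ (S.incl (φ e)) :=
      contMDiffAt_extChartAt' (by simpa [hψ] using hs)
    exact (h2.comp e h1).contDiffAt
  -- the chain rule for `ψ.symm ∘ g = i ∘ φ`
  have hder : ∀ e, e ∈ (extChartAt 𝓘(ℝ, F) y).target → S.incl (φ e) ∈ ψ.source → ∀ a : F,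
      mfderiv 𝓘(ℝ, E) 𝓘(ℝ, E) ψ.symm (g e) (fderiv ℝ g e a) =
        mfderiv 𝓘(ℝ, F) 𝓘(ℝ, E) S.incl (φ e) (mfderiv 𝓘(ℝ, F) 𝓘(ℝ, F) φ e a) := by
    intro e he hs a
    have hψt : g e ∈ ψ.target := ψ.map_source hs
    have h1 : MDifferentiableAt 𝓘(ℝ, E) 𝓘(ℝ, E) ψ.symm (g e) :=
      (((contMDiffOn_extChartAt_symm (n := ∞) (S.incl y)) _ hψt).contMDiffAt
        ((isOpen_extChartAt_target _).mem_nhds hψt)).mdifferentiableAt (by simp)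
    have h2 : MDifferentiableAt 𝓘(ℝ, F) 𝓘(ℝ, E) g e :=
      ((hgs e he hs).differentiableAt (by simp)).mdifferentiableAt
    have h3 : MDifferentiableAt 𝓘(ℝ, F) 𝓘(ℝ, E) S.incl (φ e) :=
      hi.mdifferentiableAt (by simp)
    have h4 : MDifferentiableAt 𝓘(ℝ, F) 𝓘(ℝ, F) φ e := (hφat e he).mdifferentiableAt (by simp)
    have heq : (ψ.symm ∘ g) =ᶠ[𝓝 e] (S.incl ∘ φ) := by
      have hc : ContinuousAt (fun e => S.incl (φ e)) e :=
        (hi.continuous.continuousAt).comp (hφat e he).continuousAt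
      have := hc.eventually_mem ((isOpen_extChartAt_source (I := 𝓘(ℝ, E)) (S.incl y)).mem_nhds hs)
      filter_upwards [this] with z hz
      exact ψ.left_inv hz
    have h5 := mfderiv_comp e h1 h2
    have h6 := mfderiv_comp e h3 h4
    have h7 := heq.mfderiv_eq (I := 𝓘(ℝ, F)) (I' := 𝓘(ℝ, E))
    have h8 : (mfderiv 𝓘(ℝ, E) 𝓘(ℝ, E) ψ.symm (g e)).comp (mfderiv 𝓘(ℝ, F) 𝓘(ℝ, E) g e) a =
        (mfderiv 𝓘(ℝ, F) 𝓘(ℝ, E) S.incl (φ e)).comp (mfderiv 𝓘(ℝ, F) 𝓘(ℝ, F) φ e) a := by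
      rw [← h5, ← h6]
      exact congrArg (fun L => L a) h7
    rw [mfderiv_eq_fderiv] at h8
    exact h8
  -- the pulled-back form in the chart
  set η : F → F [⋀^Fin 2]→L[ℝ] ℝ := fun e =>
    (twoFormInChart Ω.form (S.incl y) (g e)).compContinuousLinearMap (fderiv ℝ g e) with hη
  have hηapp : ∀ e, e ∈ (extChartAt 𝓘(ℝ, F) y).target → S.incl (φ e) ∈ ψ.source → ∀ a b : F,
      η e ![a, b] = Ω.form (S.incl (φ e))
        ![mfderiv 𝓘(ℝ, F) 𝓘(ℝ, E) S.incl (φ e) (mfderiv 𝓘(ℝ, F) 𝓘(ℝ, F) φ e a),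
          mfderiv 𝓘(ℝ, F) 𝓘(ℝ, E) S.incl (φ e) (mfderiv 𝓘(ℝ, F) 𝓘(ℝ, F) φ e b)] := by
    intro e he hs a b
    have hpt : ψ.symm (g e) = S.incl (φ e) := ψ.left_inv hs
    have h1 : η e ![a, b] = Ω.form (ψ.symm (g e))
        ![mfderiv 𝓘(ℝ, E) 𝓘(ℝ, E) ψ.symm (g e) (fderiv ℝ g e a),
          mfderiv 𝓘(ℝ, E) 𝓘(ℝ, E) ψ.symm (g e) (fderiv ℝ g e b)] := by
      refine congrArg (Ω.form (ψ.symm (g e))) ?_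
      funext i
      fin_cases i <;> rfl
    rw [h1, hder e he hs a, hder e he hs b, hpt]
  have hgt : g e₀ ∈ ψ.target := ψ.map_source hev₀.2
  have hΩd : DifferentiableAt ℝ (twoFormInChart Ω.form (S.incl y)) (g e₀) :=
    ((Ω.smooth (S.incl y)).contDiffAt ((isOpen_extChartAt_target _).mem_nhds hgt)).differentiableAt
      (by simp)
  have hg₀ : ContDiffAt ℝ ∞ g e₀ := hgs e₀ hev₀.1 hev₀.2
  have hηclosed : extDeriv η e₀ = 0 := by
    rw [hη, extDeriv_pullback (r := 2) hΩd (hg₀.of_le ENat.LEInfty.out) (by simp),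
      Ω.closed _ _ hgt]
    rfl
  have hηd : DifferentiableAt ℝ η e₀ := by
    have h1 : DifferentiableAt ℝ g e₀ := hg₀.differentiableAt (by simp)
    have h2 : DifferentiableAt ℝ (fderiv ℝ g) e₀ :=
      (hg₀.fderiv_right (m := 1) (by rw [one_add_one_eq_two]; exact ENat.LEInfty.out)).differentiableAt (by simp)
    exact (hΩd.comp e₀ h1).continuousAlternatingMapCompContinuousLinearMap h2
  -- the vector fields in the chart
  have : CompleteSpace F := FiniteDimensional.complete ℝ F
  obtain ⟨hat, hhat⟩ : ∃ hat : S.LeafwiseVectorField → F → F, ∀ V,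
      hat V = mpullbackWithin 𝓘(ℝ, F) 𝓘(ℝ, F) φ V.field (range 𝓘(ℝ, F)) := ⟨_, fun _ => rfl⟩
  have hpull : ∀ (V : S.LeafwiseVectorField) (e : F), e ∈ (extChartAt 𝓘(ℝ, F) y).target →
      mfderiv 𝓘(ℝ, F) 𝓘(ℝ, F) φ e (hat V e) = V.field (φ e) := by
    intro V e he
    have h := isInvertible_mfderivWithin_extChartAt_symm (I := 𝓘(ℝ, F)) (x := y) he
    have h' := h.self_apply_inverse (V.field (φ e))
    rw [hhat, mpullbackWithin_apply]
    rw [ModelWithCorners.range_eq_univ, mfderivWithin_univ] at h' ⊢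
    exact h'
  have hdiff : ∀ V : S.LeafwiseVectorField, DifferentiableAt ℝ (hat V) e₀ := by
    intro V
    have h := MDifferentiableWithinAt.differentiableWithinAt_mpullbackWithin_vectorField
      (I := 𝓘(ℝ, F)) (s := univ) (x := y) (V := V.field)
      ((V.smooth.mdifferentiable (by simp)) y).mdifferentiableWithinAt
    rw [← hhat V, ModelWithCorners.range_eq_univ, preimage_univ, inter_univ] at h
    exact differentiableWithinAt_univ.1 h
  have hzero : ∀ V : S.LeafwiseVectorField, ∀ᶠ e in 𝓝 e₀, ∀ b : F, η e ![hat V e, b] = 0 := by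
    intro V
    filter_upwards [hev] with e he b
    rw [hηapp e he.1 he.2, hpull V e he.1]
    exact (S.mem_nullDistribution _ _).1 (V.mem (φ e)) _
  have hkey : ∀ c : F, η e₀ ![lieBracket ℝ (hat σ) (hat τ) e₀, c] = 0 :=
    lieBracket_kernel hηd hηclosed (hdiff σ) (hdiff τ) (hzero σ) (hzero τ)
  have hysrc : y ∈ (extChartAt 𝓘(ℝ, F) y).source := mem_extChartAt_source y
  have hinv : (mfderiv 𝓘(ℝ, F) 𝓘(ℝ, F) φ e₀).comp
      (mfderiv 𝓘(ℝ, F) 𝓘(ℝ, F) (extChartAt 𝓘(ℝ, F) y) y) = ContinuousLinearMap.id ℝ F := by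
    have h := mfderivWithin_extChartAt_symm_comp_mfderiv_extChartAt' (I := 𝓘(ℝ, F)) hysrc
    rw [ModelWithCorners.range_eq_univ, mfderivWithin_univ] at h
    exact h
  obtain ⟨L, hL⟩ : ∃ L : F, L = lieBracket ℝ (hat σ) (hat τ) e₀ := ⟨_, rfl⟩
  rw [← hL] at hkey
  have hbr : mlieBracket 𝓘(ℝ, F) σ.field τ.field y = mfderiv 𝓘(ℝ, F) 𝓘(ℝ, F) φ e₀ L := by
    have h1 := mlieBracketWithin_apply (I := 𝓘(ℝ, F)) (V := σ.field) (W := τ.field)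
      (s := univ) (x₀ := y)
    rw [mlieBracketWithin_univ, ← hφ, ← hhat σ, ← hhat τ, preimage_univ,
      ModelWithCorners.range_eq_univ, inter_univ] at h1
    have h2 := (isInvertible_mfderiv_extChartAt (I := 𝓘(ℝ, F)) hysrc).self_apply_inverse L
    have h3 : mlieBracket 𝓘(ℝ, F) σ.field τ.field y =
        (mfderiv 𝓘(ℝ, F) 𝓘(ℝ, F) (extChartAt 𝓘(ℝ, F) y) y).inverse L := by
      rw [h1, hL, ← lieBracketWithin_univ]
    have h4 := congrArg (fun T : F →L[ℝ] F =>
      T ((mfderiv 𝓘(ℝ, F) 𝓘(ℝ, F) (extChartAt 𝓘(ℝ, F) y) y).inverse L)) hinv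
    rw [h3]
    refine Eq.trans h4.symm ?_
    exact congrArg (mfderiv 𝓘(ℝ, F) 𝓘(ℝ, F) φ e₀) h2
  have hP : ∀ z : Y, φ e₀ = z → ∀ u v : F,
      Ω.form (S.incl (φ e₀)) ![mfderiv 𝓘(ℝ, F) 𝓘(ℝ, E) S.incl (φ e₀) u,
        mfderiv 𝓘(ℝ, F) 𝓘(ℝ, E) S.incl (φ e₀) v] = 0 →
      Ω.form (S.incl z) ![mfderiv 𝓘(ℝ, F) 𝓘(ℝ, E) S.incl z u,
        mfderiv 𝓘(ℝ, F) 𝓘(ℝ, E) S.incl z v] = 0 := by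
    rintro z rfl u v h
    exact h
  obtain ⟨c, hc⟩ : ∃ c : F, c = mfderiv 𝓘(ℝ, F) 𝓘(ℝ, F) (extChartAt 𝓘(ℝ, F) y) y w := ⟨_, rfl⟩
  have hw : mfderiv 𝓘(ℝ, F) 𝓘(ℝ, F) φ e₀ c = w := by
    rw [hc]
    exact congrArg (fun T : F →L[ℝ] F => T w) hinv
  have h := hkey c
  rw [hηapp e₀ hev₀.1 hev₀.2] at h
  have h' := hP y hφe₀ _ _ h
  rw [hw] at h'
  rw [hbr]
  exact h'

/-! ### The leafwise de Rham complex in degrees `0, 1, 2` and the cohomology `H¹(𝓕)` -/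

/-- `Ω¹(𝓕) = Γ(T*𝓕)`: the leafwise `1`-forms, i.e. the smooth sections of the dual bundle of
`T𝓕`. Smoothness is tested against the smooth sections of `T𝓕`. -/
def leafwiseOneForms (S : CoisotropicSubmanifold Ω F Y) :
    Submodule ℝ (∀ y : Y, S.nullDistribution y →ₗ[ℝ] ℝ) where
  carrier := {ξ | ∀ σ : S.LeafwiseVectorField,
    ContMDiff 𝓘(ℝ, F) 𝓘(ℝ, ℝ) ∞ (fun y => ξ y ⟨σ.field y, σ.mem y⟩)}
  zero_mem' _ := contMDiff_const
  add_mem' ha hb σ := (ha σ).add (hb σ)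
  smul_mem' c ξ ha σ := by
    have h : ContMDiff 𝓘(ℝ, ℝ) 𝓘(ℝ, ℝ) ∞ (fun r : ℝ => c * r) :=
      (contDiff_const.mul contDiff_id).contMDiff
    exact h.comp (ha σ)

/-- The type `Ω¹(𝓕)` of leafwise `1`-forms. -/
def LeafwiseOneForm (S : CoisotropicSubmanifold Ω F Y) : Type _ :=
  {ξ : ∀ y : Y, S.nullDistribution y →ₗ[ℝ] ℝ // ξ ∈ S.leafwiseOneForms}

noncomputable instance (S : CoisotropicSubmanifold Ω F Y) : AddCommGroup S.LeafwiseOneForm :=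
  inferInstanceAs (AddCommGroup S.leafwiseOneForms)

noncomputable instance (S : CoisotropicSubmanifold Ω F Y) : Module ℝ S.LeafwiseOneForm :=
  inferInstanceAs (Module ℝ S.leafwiseOneForms)

/-- The value `ξ(σ)` of a leafwise `1`-form on a leafwise vector field, a function on `Y`. -/
noncomputable def eval {S : CoisotropicSubmanifold Ω F Y} (ξ : S.LeafwiseOneForm)
    (σ : S.LeafwiseVectorField) (y : Y) : ℝ :=
  ξ.1 y ⟨σ.field y, σ.mem y⟩

/-- The leafwise differential `d_𝓕 : Ω⁰(𝓕) = C^∞(Y) → Ω¹(𝓕)`, `(d_𝓕 f)(v) = df(v)`. -/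
noncomputable def d₀ (S : CoisotropicSubmanifold Ω F Y) :
    C^∞⟮𝓘(ℝ, F), Y; 𝓘(ℝ, ℝ), ℝ⟯ →ₗ[ℝ] S.LeafwiseOneForm where
  toFun f := ⟨fun y => (mfderiv 𝓘(ℝ, F) 𝓘(ℝ, ℝ) f y).toLinearMap ∘ₗ (S.nullDistribution y).subtype,
    fun (σ : S.LeafwiseVectorField) => by
      have h1 : ContMDiff 𝓘(ℝ, F).tangent 𝓘(ℝ, ℝ).tangent ∞ (tangentMap 𝓘(ℝ, F) 𝓘(ℝ, ℝ) f) :=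
        f.contMDiff.contMDiff_tangentMap (by simp)
      exact (contMDiff_snd_tangentBundle_modelSpace ℝ 𝓘(ℝ, ℝ)).comp (h1.comp σ.smooth)⟩
  map_add' f g := by
    refine Subtype.ext (funext fun y => LinearMap.ext fun v => ?_)
    have hf : MDifferentiableAt 𝓘(ℝ, F) 𝓘(ℝ, ℝ) f y := f.contMDiff.mdifferentiable (by simp) y
    have hg : MDifferentiableAt 𝓘(ℝ, F) 𝓘(ℝ, ℝ) g y := g.contMDiff.mdifferentiable (by simp) y
    exact congrArg (fun T => T v.1) (mfderiv_add hf hg)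
  map_smul' c f := by
    refine Subtype.ext (funext fun y => LinearMap.ext fun v => ?_)
    have hf : MDifferentiableAt 𝓘(ℝ, F) 𝓘(ℝ, ℝ) f y := f.contMDiff.mdifferentiable (by simp) y
    exact congrArg (fun T => T v.1) (const_smul_mfderiv hf c)

/-- The derivative `v(f)` of a function `f` on `Y` along a tangent vector `v`. -/
noncomputable def derivAlong (f : Y → ℝ) {y : Y} (v : TangentSpace 𝓘(ℝ, F) y) : ℝ :=
  mfderiv 𝓘(ℝ, F) 𝓘(ℝ, ℝ) f y v

open VectorField in
/-- The leafwise differential `d_𝓕` of leafwise `1`-forms, given by its values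
`(d_𝓕 ξ)(σ, τ) = σ(ξ(τ)) - τ(ξ(σ)) - ξ([σ, τ])` on pairs of leafwise vector fields. -/
noncomputable def d₁ (S : CoisotropicSubmanifold Ω F Y) :
    S.LeafwiseOneForm →ₗ[ℝ] (S.LeafwiseVectorField → S.LeafwiseVectorField → Y → ℝ) where
  toFun ξ σ τ y :=
    derivAlong (eval ξ τ) (σ.field y) - derivAlong (eval ξ σ) (τ.field y)
      - ξ.1 y ⟨mlieBracket 𝓘(ℝ, F) σ.field τ.field y, S.mlieBracket_mem σ τ y⟩
  map_add' ξ ζ := by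
    funext σ τ y
    have hd : ∀ (κ : S.LeafwiseOneForm) (ρ : S.LeafwiseVectorField),
        MDifferentiableAt 𝓘(ℝ, F) 𝓘(ℝ, ℝ) (eval κ ρ) y :=
      fun κ ρ => (κ.2 ρ).mdifferentiable (by simp) y
    have h : ∀ (ρ : S.LeafwiseVectorField) (v : TangentSpace 𝓘(ℝ, F) y),
        derivAlong (eval (ξ + ζ) ρ) v = derivAlong (eval ξ ρ) v + derivAlong (eval ζ ρ) v :=
      fun ρ v => congrArg (fun T => T v) (mfderiv_add (hd ξ ρ) (hd ζ ρ))
    have h' : ∀ v : S.nullDistribution y, (ξ + ζ).1 y v = ξ.1 y v + ζ.1 y v := fun _ => rfl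
    simp only [h, h', Pi.add_apply]
    ring
  map_smul' c ξ := by
    funext σ τ y
    have hd : ∀ ρ : S.LeafwiseVectorField, MDifferentiableAt 𝓘(ℝ, F) 𝓘(ℝ, ℝ) (eval ξ ρ) y :=
      fun ρ => (ξ.2 ρ).mdifferentiable (by simp) y
    have h : ∀ (ρ : S.LeafwiseVectorField) (v : TangentSpace 𝓘(ℝ, F) y),
        derivAlong (eval (c • ξ) ρ) v = c * derivAlong (eval ξ ρ) v :=
      fun ρ v => congrArg (fun T => T v) (const_smul_mfderiv (hd ρ) c)
    have h' : ∀ v : S.nullDistribution y, (c • ξ).1 y v = c * ξ.1 y v := fun _ => rfl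
    simp only [h, h', Pi.smul_apply, smul_eq_mul, RingHom.id_apply]
    ring

/-- The first leafwise cohomology `H¹(𝓕) = ker (d_𝓕 on Ω¹(𝓕)) / im (d_𝓕 on Ω⁰(𝓕))`. -/
abbrev H1 (S : CoisotropicSubmanifold Ω F Y) : Type _ :=
  LinearMap.ker S.d₁ ⧸ (LinearMap.range S.d₀).submoduleOf (LinearMap.ker S.d₁)

end NullFoliation

section Deformations

variable {E : Type*} [NormedAddCommGroup E] [NormedSpace ℝ E]
  {X : Type*} [TopologicalSpace X] [ChartedSpace E X] {Ω : SymplecticForm E X}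
  {F : Type*} [NormedAddCommGroup F] [NormedSpace ℝ F]
  {Y : Type*} [TopologicalSpace Y] [ChartedSpace F Y]
  [IsManifold 𝓘(ℝ, F) ∞ Y] [IsManifold 𝓘(ℝ, E) ∞ X]

/-! ### Infinitesimal deformations -/

/-- A smooth deformation of `Y` in `X`: a family of maps `φ t : Y → X` with `φ 0 = i`, defined
and smooth on an open neighbourhood of `{0} × Y` in `ℝ × Y` (the values of `φ` elsewhere are
irrelevant). -/
structure IsDeformation (S : CoisotropicSubmanifold Ω F Y) (φ : ℝ → Y → X) : Prop where
  zero : φ 0 = S.incl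
  smooth : ∃ W : Set (ℝ × Y), IsOpen W ∧ (∀ y, ((0 : ℝ), y) ∈ W) ∧
    ContMDiffOn (𝓘(ℝ, ℝ).prod 𝓘(ℝ, F)) 𝓘(ℝ, E) ∞ (fun p : ℝ × Y => φ p.1 p.2) W

/-- The normal part of the initial velocity `V = ∂φ_t/∂t|_{t=0}` of the deformation `φ` is `ξ`
under the isomorphism `NY = TX/TY ≅ T*𝓕`, `[V] ↦ Ω(V, ·)|_{T𝓕}`, given by the symplectic form. -/
def HasNormalVelocity (S : CoisotropicSubmanifold Ω F Y) (φ : ℝ → Y → X)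
    (ξ : S.LeafwiseOneForm) : Prop :=
  ∀ (y : Y) (v : S.nullDistribution y),
    Ω.form (φ 0 y) ![mfderiv 𝓘(ℝ, ℝ) 𝓘(ℝ, E) (fun t => φ t y) 0 (1 : ℝ),
      mfderiv 𝓘(ℝ, F) 𝓘(ℝ, E) (φ 0) y (v : TangentSpace 𝓘(ℝ, F) y)] = ξ.1 y v

/-- The family of submanifolds `φ_t(Y)` is coisotropic to first order at `t = 0`. A subspace `W`
of a symplectic vector space is coisotropic iff the symplectic form vanishes on `W^ω`; here
`W_t` is the image of the differential of `φ_t` at `y`, and the requirement is that the symplectic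
form on `W_t^ω` vanishes up to an error `o(t)`: for all differentiable `u_t, v_t ∈ W_t^ω`, the
function `Ω(u_t, v_t)` of `t` has vanishing derivative at `t = 0`. -/
def IsCoisotropicToFirstOrder (Ω : SymplecticForm E X) (φ : ℝ → Y → X) : Prop :=
  ∀ (y : Y) (u v : ∀ t : ℝ, TangentSpace 𝓘(ℝ, E) (φ t y)),
    MDifferentiableAt 𝓘(ℝ, ℝ) 𝓘(ℝ, E).tangent
      (fun t => (⟨φ t y, u t⟩ : TangentBundle 𝓘(ℝ, E) X)) 0 →
    MDifferentiableAt 𝓘(ℝ, ℝ) 𝓘(ℝ, E).tangent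
      (fun t => (⟨φ t y, v t⟩ : TangentBundle 𝓘(ℝ, E) X)) 0 →
    (∀ᶠ t in 𝓝 (0 : ℝ),
      u t ∈ Ω.orthogonal (LinearMap.range (mfderiv 𝓘(ℝ, F) 𝓘(ℝ, E) (φ t) y).toLinearMap) ∧
      v t ∈ Ω.orthogonal (LinearMap.range (mfderiv 𝓘(ℝ, F) 𝓘(ℝ, E) (φ t) y).toLinearMap)) →
    HasDerivAt (fun t => Ω.form (φ t y) ![u t, v t]) 0 0

/-- `ξ` is an infinitesimal deformation of the coisotropic submanifold `Y`: it is the normal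
velocity at `t = 0` of a smooth deformation of `Y` that is coisotropic to first order. -/
def IsInfinitesimalDeformation (S : CoisotropicSubmanifold Ω F Y) (ξ : S.LeafwiseOneForm) :
    Prop :=
  ∃ φ : ℝ → Y → X, S.IsDeformation φ ∧ S.HasNormalVelocity φ ξ ∧
    IsCoisotropicToFirstOrder (F := F) Ω φ

/-- `ξ` is an infinitesimal Hamiltonian deformation of `Y`: it is the normal part along `Y`, under
`NY ≅ T*𝓕`, of the Hamiltonian vector field `Z` (`Ω(Z, ·) = dh`) of a smooth function `h` on an
open neighbourhood `O` of `Y`. -/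
def IsInfinitesimalHamiltonian (S : CoisotropicSubmanifold Ω F Y) (ξ : S.LeafwiseOneForm) :
    Prop :=
  ∃ (O : Set X) (h : X → ℝ) (Z : ∀ x : X, TangentSpace 𝓘(ℝ, E) x),
    IsOpen O ∧ range S.incl ⊆ O ∧ ContMDiffOn 𝓘(ℝ, E) 𝓘(ℝ, ℝ) ∞ h O ∧
    (∀ x ∈ O, ∀ w : TangentSpace 𝓘(ℝ, E) x,
      Ω.form x ![Z x, w] = mfderiv 𝓘(ℝ, E) 𝓘(ℝ, ℝ) h x w) ∧
    ∀ (y : Y) (v : S.nullDistribution y),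
      Ω.form (S.incl y) ![Z (S.incl y),
        mfderiv 𝓘(ℝ, F) 𝓘(ℝ, E) S.incl y (v : TangentSpace 𝓘(ℝ, F) y)] = ξ.1 y v

end Deformations

end CoisotropicSubmanifold

/-! The core is a first variation formula. In charts a deformation is a map `G (t, e)`; let `α =
G₀^*(ι_V ω)`, where `V` is its initial velocity. On `T𝓕` the form `α` agrees with the normal
velocity `ξ`, so on null vectors `d_𝓕 ξ` is the exterior derivative `dα` (`d₁_eq_of_chart`). Since
`ω` is closed, Cartan's formula says that `G_t^*ω` has derivative `dα` at `t = 0`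
(`hasDerivAt_pullback_twoForm`).

Let `u_t, v_t ∈ W_t^ω`. By coisotropy `u_0 = dG_0(a)` and `v_0 = dG_0(b)` for null vectors `a, b`.
The function `ω(u_t - dG_t a, v_t - dG_t b)` is a product of two factors vanishing at `t = 0`, so
its derivative there is zero. Its mixed terms vanish by orthogonality, which leaves `d/dt ω(u_t,
v_t) = -dα(a, b) = -(d_𝓕 ξ)(a, b)` (`IsDeformation.hasDerivAt_form`). Equivalence with `d_𝓕 ξ = 0`
needs enough test objects: null vectors must extend to leafwise fields and to curves in `W_t^ω`.
Both come from smooth frames of orthogonal complements (`exists_smooth_orthogonal_frame`).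

For the characterization of infinitesimal deformations, every `ξ` must also be a normal velocity.
Locally `ξ` is the normal part of a smooth field along `Y`. The local fields are cut off by a
partition of unity and applied as successive translations in charts of `X`; at time zero nothing has
moved, so the velocities add (`exists_germFamily`).

For Hamiltonian deformations, `ω(Z, di v) = dh(di v) = d(h ∘ i)(v)` shows that the normal part is
`d_𝓕` of the restriction of `h`, and every function on `Y` extends to a neighbourhood
(`exists_extension`). Thus `D = ker d₁`, `T = im d₀`, and `D / T` is `H¹(𝓕)` by definition. -/

set_option linter.unusedSectionVars false

/-! ### Linear algebra of smooth families -/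

/-- The bilinear map `(a, b) ↦ β ![a, b]` associated with an alternating `2`-form `β`, depending
linearly and continuously on `β`. -/
noncomputable def twoFormBilin (E : Type*) [NormedAddCommGroup E] [NormedSpace ℝ E] :
    (E [⋀^Fin 2]→L[ℝ] ℝ) →L[ℝ] (E →L[ℝ] E →L[ℝ] ℝ) :=
  (ContinuousLinearMap.compL ℝ E (E [⋀^Fin 1]→L[ℝ] ℝ) (E →L[ℝ] ℝ)
    ((ContinuousAlternatingMap.ofSubsingletonLIE (𝕜 := ℝ) (E := E) (F := ℝ)
      (0 : Fin 1)).symm.toContinuousLinearEquiv.toContinuousLinearMap)).comp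
    (ContinuousAlternatingMap.curryLeftLI (𝕜 := ℝ) (E := E) (F := ℝ) (n := 1)).toContinuousLinearMap

section Families

variable {E F Z : Type*} [NormedAddCommGroup E] [NormedSpace ℝ E]
  [NormedAddCommGroup F] [NormedSpace ℝ F] [NormedAddCommGroup Z] [NormedSpace ℝ Z]

theorem twoFormBilin_apply (β : E [⋀^Fin 2]→L[ℝ] ℝ) (a b : E) :
    twoFormBilin E β a b = β ![a, b] := by
  change β (Matrix.vecCons a _) = _
  congr 1
  funext i
  fin_cases i <;> rfl

theorem twoFormBilin_swap (β : E [⋀^Fin 2]→L[ℝ] ℝ) (a b : E) :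
    twoFormBilin E β a b = - twoFormBilin E β b a := by
  rw [twoFormBilin_apply, twoFormBilin_apply]
  have h := β.toAlternatingMap.map_swap ![b, a] (i := 0) (j := 1) (by simp)
  have h2 : (![b, a] : Fin 2 → E) ∘ Equiv.swap 0 1 = ![a, b] := by
    funext i; fin_cases i <;> simp
  rw [h2] at h
  exact h

theorem contDiff_twoFormBilin : ContDiff ℝ ∞ fun β : E [⋀^Fin 2]→L[ℝ] ℝ => twoFormBilin E β :=
  ContinuousLinearMap.contDiff (𝕜 := ℝ) (E := E [⋀^Fin 2]→L[ℝ] ℝ) (F := E →L[ℝ] E →L[ℝ] ℝ)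
    (twoFormBilin E)

attribute [irreducible] twoFormBilin

/-- A smooth family of linear maps `M z` that is invertible at `z₀` has a smooth family of two-sided
inverses near `z₀`. -/
theorem eventually_inverse {G H : Type*} [NormedAddCommGroup G] [NormedSpace ℝ G] [CompleteSpace G]
    [NormedAddCommGroup H] [NormedSpace ℝ H]
    {M : Z → G →L[ℝ] H} {z₀ : Z} (hM : ∀ᶠ z in 𝓝 z₀, ContDiffAt ℝ ∞ M z)
    (T : G ≃L[ℝ] H) (hT : M z₀ = T) :
    ∃ N : Z → H →L[ℝ] G, (∀ᶠ z in 𝓝 z₀, ContDiffAt ℝ ∞ N z) ∧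
      ∀ᶠ z in 𝓝 z₀, (∀ x, N z (M z x) = x) ∧ ∀ y, M z (N z y) = y := by
  have hev : ∀ᶠ z in 𝓝 z₀, (M z).IsInvertible := by
    have hc : ContinuousAt M z₀ := hM.self_of_nhds.continuousAt
    -- Invertible operators form a neighbourhood of `T`, so continuity of `M` keeps nearby `M z`
    -- invertible.
    have h := T.nhds
    rw [← hT] at h
    filter_upwards [hc h] with z hz
    exact hz
  refine ⟨fun z => (M z).inverse, ?_, ?_⟩
  · filter_upwards [hM, hev] with z hz hi
    exact (hi.contDiffAt_map_inverse (n := ∞)).comp z hz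
  · filter_upwards [hev] with z hi
    exact ⟨fun x => hi.inverse_apply_self x, fun y => hi.self_apply_inverse y⟩

/-- A smooth family of linear maps that is injective at `z₀` has a smooth family of left inverses
near `z₀`. -/
theorem exists_smooth_leftInverse [FiniteDimensional ℝ E] [FiniteDimensional ℝ F]
    {L : Z → F →L[ℝ] E} {z₀ : Z} (hL : ∀ᶠ z in 𝓝 z₀, ContDiffAt ℝ ∞ L z)
    (hinj : Function.Injective (L z₀)) :
    ∃ r : Z → E →L[ℝ] F, (∀ᶠ z in 𝓝 z₀, ContDiffAt ℝ ∞ r z) ∧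
      ∀ᶠ z in 𝓝 z₀, ∀ a, r z (L z a) = a := by
  have : CompleteSpace F := FiniteDimensional.complete ℝ F
  obtain ⟨r₀, hr₀⟩ := (L z₀ : F →ₗ[ℝ] E).exists_leftInverse_of_injective
    (LinearMap.ker_eq_bot.2 hinj)
  -- `R` is a fixed left inverse of `L z₀`. Near `z₀` the map `R ∘ L z` is close to the identity,
  -- and `(R ∘ L z)⁻¹ ∘ R` is a left inverse of `L z`.
  set R : E →L[ℝ] F := LinearMap.toContinuousLinearMap r₀ with hR
  have hM : ∀ᶠ z in 𝓝 z₀, ContDiffAt ℝ ∞ (fun z => R.comp (L z)) z := by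
    filter_upwards [hL] with z hz
    exact contDiffAt_const.clm_comp hz
  obtain ⟨N, hN, hN'⟩ := eventually_inverse hM (ContinuousLinearEquiv.refl ℝ F) (by
    ext a
    exact LinearMap.congr_fun hr₀ a)
  refine ⟨fun z => (N z).comp R, ?_, ?_⟩
  · filter_upwards [hN] with z hz
    exact hz.clm_comp contDiffAt_const
  · filter_upwards [hN'] with z hz a
    exact hz.1 a

/-- Smooth frames of orthogonal complements: if `L z` is injective and `B z` is nondegenerate at
`z₀`, there is a smooth family of linear maps `s z` onto the `B z`-orthogonal of the range of `L z`,
such that an orthogonal vector `u` is recovered from the functional `B z u`. -/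
theorem exists_smooth_orthogonal_frame [FiniteDimensional ℝ E] [FiniteDimensional ℝ F]
    {L : Z → F →L[ℝ] E} {B : Z → E →L[ℝ] E →L[ℝ] ℝ} {z₀ : Z}
    (hL : ∀ᶠ z in 𝓝 z₀, ContDiffAt ℝ ∞ L z) (hB : ∀ᶠ z in 𝓝 z₀, ContDiffAt ℝ ∞ B z)
    (hinj : Function.Injective (L z₀)) (hnd : ∀ u, (∀ w, B z₀ u w = 0) → u = 0) :
    ∃ s : Z → (E →L[ℝ] ℝ) →L[ℝ] E, (∀ᶠ z in 𝓝 z₀, ContDiffAt ℝ ∞ s z) ∧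
      ∀ᶠ z in 𝓝 z₀, (∀ γ a, B z (s z γ) (L z a) = 0) ∧
        ∀ u, (∀ a, B z u (L z a) = 0) → s z (B z u) = u := by
  have : CompleteSpace E := FiniteDimensional.complete ℝ E
  obtain ⟨r₀, hr₀⟩ := (L z₀ : F →ₗ[ℝ] E).exists_leftInverse_of_injective
    (LinearMap.ker_eq_bot.2 hinj)
  set R : E →L[ℝ] F := LinearMap.toContinuousLinearMap r₀ with hR
  have hRL : ∀ a, R (L z₀ a) = a := fun a => LinearMap.congr_fun hr₀ a
  -- `q` is a projection with kernel the range of `L z₀`.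
  set q : E →L[ℝ] E := ContinuousLinearMap.id ℝ E - (L z₀).comp R with hq
  have hqL : ∀ a, q (L z₀ a) = 0 := by
    intro a
    simp [hq, hRL]
  have hRq : ∀ w, R (q w) = 0 := by
    intro w
    simp [hq, hRL]
  have hqq : ∀ w, q (q w) = q w := by
    intro w
    change q w - L z₀ (R (q w)) = q w
    rw [hRq, map_zero, sub_zero]
  -- `P z` deforms the identity `P z₀`: it carries the range of `L z₀` to that of `L z` and fixes
  -- the range of `q`. Hence `u` is orthogonal to the range of `L z` exactly when the functional `M
  -- z u = B z u ∘ P z` kills the fixed subspace `range (L z₀)`, that is, when it factors through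
  -- `q`.
  set P : Z → E →L[ℝ] E := fun z => (L z).comp R + q with hP
  have hPL : ∀ z a, P z (L z₀ a) = L z a := by
    intro z a
    simp [hP, hRL, hqL]
  have hPq : ∀ z w, P z (q w) = q w := by
    intro z w
    change L z (R (q w)) + q (q w) = q w
    rw [hRq, hqq, map_zero, zero_add]
  set M : Z → E →L[ℝ] E →L[ℝ] ℝ := fun z =>
    ((ContinuousLinearMap.compL ℝ E E ℝ).flip (P z)).comp (B z) with hMdef
  have hMapp : ∀ z u w, M z u w = B z u (P z w) := fun _ _ _ => rfl
  have hM : ∀ᶠ z in 𝓝 z₀, ContDiffAt ℝ ∞ M z := by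
    filter_upwards [hL, hB] with z hz hz'
    have h1 : ContDiffAt ℝ ∞ P z := (hz.clm_comp contDiffAt_const).add contDiffAt_const
    exact (((ContinuousLinearMap.compL ℝ E E ℝ).flip.contDiff.contDiffAt).comp z h1).clm_comp hz'
  have hP₀ : ∀ w, P z₀ w = w := by
    intro w
    simp [hP, hq]
  have hker : LinearMap.ker (M z₀ : E →ₗ[ℝ] E →L[ℝ] ℝ) = ⊥ := by
    refine LinearMap.ker_eq_bot'.2 fun u hu => hnd u fun w => ?_
    have h := congrArg (fun T : E →L[ℝ] ℝ => T w) hu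
    have h' : M z₀ u w = 0 := h
    rwa [hMapp, hP₀] at h'
  have hdim : Module.finrank ℝ E = Module.finrank ℝ (E →L[ℝ] ℝ) := by
    rw [← (LinearMap.toContinuousLinearMap (𝕜 := ℝ) (E := E) (F' := ℝ)).finrank_eq]
    exact (Subspace.dual_finrank_eq (K := ℝ) (V := E)).symm
  have hfd : FiniteDimensional ℝ (E →L[ℝ] ℝ) :=
    (LinearMap.toContinuousLinearMap (𝕜 := ℝ) (E := E) (F' := ℝ)).finiteDimensional
  let T : E ≃L[ℝ] (E →L[ℝ] ℝ) :=
    (LinearEquiv.ofInjectiveOfFinrankEq (M z₀ : E →ₗ[ℝ] E →L[ℝ] ℝ)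
      (LinearMap.ker_eq_bot.1 hker) hdim).toContinuousLinearEquiv
  obtain ⟨N, hN, hN'⟩ := eventually_inverse hM T (by ext u; rfl)
  -- The frame is `s z γ = (M z)⁻¹ (γ ∘ q)`.
  refine ⟨fun z => (N z).comp ((ContinuousLinearMap.compL ℝ E E ℝ).flip q), ?_, ?_⟩
  · filter_upwards [hN] with z hz
    exact hz.clm_comp contDiffAt_const
  · filter_upwards [hN'] with z hz
    refine ⟨fun γ a => ?_, fun u hu => ?_⟩
    · rw [← hPL z a, ← hMapp]
      change M z (N z (γ.comp q)) (L z₀ a) = 0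
      rw [hz.2]
      simp [hqL]
    · change N z ((B z u).comp q) = u
      -- For orthogonal `u` the summand `(L z) ∘ R` of `P z` contributes nothing, so `γ = B z u`
      -- already represents `M z u`.
      have h : (B z u).comp q = M z u := by
        ext w
        rw [hMapp]
        simp [hP, hu]
      rw [h, hz.1]

end Families

/-! ### First variation of a closed `2`-form -/

section FirstVariation

variable {E F : Type*} [NormedAddCommGroup E] [NormedSpace ℝ E]
  [NormedAddCommGroup F] [NormedSpace ℝ F]

/-- The `1`-form `G₀^*(ι_V β)`, where `V = ∂G/∂t` at `t = 0` is the velocity of the family of maps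
`G (t, ·)`. -/
noncomputable def velocityForm (β : E → E [⋀^Fin 2]→L[ℝ] ℝ) (G : ℝ × F → E) (e : F) : F →L[ℝ] ℝ :=
  (twoFormBilin E (β (G (0, e))) (fderiv ℝ G (0, e) (1, 0))).comp
    ((fderiv ℝ G (0, e)).comp (ContinuousLinearMap.inr ℝ ℝ F))

theorem velocityForm_apply (β : E → E [⋀^Fin 2]→L[ℝ] ℝ) (G : ℝ × F → E) (e a : F) :
    velocityForm β G e a =
      twoFormBilin E (β (G (0, e))) (fderiv ℝ G (0, e) (1, 0)) (fderiv ℝ G (0, e) (0, a)) :=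
  rfl

variable {β : E → E [⋀^Fin 2]→L[ℝ] ℝ} {G : ℝ × F → E} {e₀ : F}

theorem differentiableAt_twoFormBilin_comp (hG : ContDiffAt ℝ ∞ G (0, e₀))
    (hβ : DifferentiableAt ℝ β (G (0, e₀))) :
    DifferentiableAt ℝ (fun p => twoFormBilin E (β (G p))) (0, e₀) :=
  (contDiff_twoFormBilin.differentiable (by simp)).differentiableAt.comp ((0 : ℝ), e₀)
    (hβ.comp ((0 : ℝ), e₀) (hG.differentiableAt (by simp)))

theorem differentiableAt_fderiv_of_contDiffAt {G : ℝ × F → E} {p : ℝ × F}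
    (hG : ContDiffAt ℝ ∞ G p) : DifferentiableAt ℝ (fderiv ℝ G) p :=
  (hG.fderiv_right (m := 1) (by rw [one_add_one_eq_two]; exact ENat.LEInfty.out)).differentiableAt
    (by simp)

theorem differentiableAt_velocityForm (hG : ContDiffAt ℝ ∞ G (0, e₀))
    (hβ : DifferentiableAt ℝ β (G (0, e₀))) : DifferentiableAt ℝ (velocityForm β G) e₀ := by
  have hi : DifferentiableAt ℝ (fun e : F => ((0 : ℝ), e)) e₀ := by fun_prop
  have h1 : DifferentiableAt ℝ (fun e : F => fderiv ℝ G (0, e)) e₀ :=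
    (differentiableAt_fderiv_of_contDiffAt hG).comp e₀ hi
  have h2 : DifferentiableAt ℝ (fun e : F => twoFormBilin E (β (G (0, e)))) e₀ :=
    DifferentiableAt.comp (g := fun p => twoFormBilin E (β (G p))) e₀
      (differentiableAt_twoFormBilin_comp hG hβ) hi
  exact (h2.clm_apply (h1.clm_apply (differentiableAt_const _))).clm_comp
    (h1.clm_comp (differentiableAt_const _))

/-- Cartan's formula for a closed `2`-form: the pull-backs of `β` along the family of maps
`G (t, ·)` vary at `t = 0` by the exterior derivative of the velocity form. -/
theorem hasDerivAt_pullback_twoForm (hG : ContDiffAt ℝ ∞ G (0, e₀))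
    (hβ : DifferentiableAt ℝ β (G (0, e₀))) (hclosed : extDeriv β (G (0, e₀)) = 0) (a b : F) :
    HasDerivAt (fun t : ℝ => twoFormBilin E (β (G (t, e₀))) (fderiv ℝ G (t, e₀) (0, a))
        (fderiv ℝ G (t, e₀) (0, b)))
      (fderiv ℝ (velocityForm β G) e₀ a b - fderiv ℝ (velocityForm β G) e₀ b a) 0 := by
  set p₀ : ℝ × F := (0, e₀) with hp₀
  have hG' := differentiableAt_fderiv_of_contDiffAt hG
  have hB := differentiableAt_twoFormBilin_comp hG hβ
  -- Pulling back by the whole map `G` puts time on the same footing as space. Then `dη = 0`,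
  -- evaluated on the constant fields `∂_t, a, b`, is Cartan's formula.
  set η : ℝ × F → (ℝ × F) [⋀^Fin 2]→L[ℝ] ℝ := fun p =>
    (β (G p)).compContinuousLinearMap (fderiv ℝ G p) with hη
  have hηapp : ∀ p x y, η p ![x, y] =
      twoFormBilin E (β (G p)) (fderiv ℝ G p x) (fderiv ℝ G p y) := by
    intro p x y
    rw [twoFormBilin_apply]
    refine congrArg (β (G p)) ?_
    funext i
    fin_cases i <;> rfl
  have hηclosed : extDeriv η p₀ = 0 := by
    rw [hη, extDeriv_pullback (r := ∞) hβ hG (by simp; exact ENat.LEInfty.out), hclosed]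
    rfl
  have hηd : DifferentiableAt ℝ η p₀ :=
    (hβ.comp p₀ (hG.differentiableAt (by simp))).continuousAlternatingMapCompContinuousLinearMap hG'
  have hd : ∀ x y, DifferentiableAt ℝ (fun p => twoFormBilin E (β (G p)) (fderiv ℝ G p x)
      (fderiv ℝ G p y)) p₀ := fun x y =>
    (hB.clm_apply (hG'.clm_apply (differentiableAt_const _))).clm_apply
      (hG'.clm_apply (differentiableAt_const _))
  have h := extDeriv_apply hηd ![(1, 0), (0, a), (0, b)]
  have s3 : ∀ f : Fin (1 + 2) → ℝ, ∑ i, f i = f 0 + f 1 + f 2 := fun f => Fin.sum_univ_three f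
  have r0 : ∀ a b c : ℝ × F, Fin.removeNth (0 : Fin (1 + 2)) ![a, b, c] = ![b, c] := by
    intro a b c; funext i; fin_cases i <;> rfl
  have r1 : ∀ a b c : ℝ × F, Fin.removeNth (1 : Fin (1 + 2)) ![a, b, c] = ![a, c] := by
    intro a b c; funext i; fin_cases i <;> rfl
  have r2 : ∀ a b c : ℝ × F, Fin.removeNth (2 : Fin (1 + 2)) ![a, b, c] = ![a, b] := by
    intro a b c; funext i; fin_cases i <;> rfl
  have h' : 0 = fderiv ℝ (fun p => η p ![(0, a), (0, b)]) p₀ (1, 0) -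
      fderiv ℝ (fun p => η p ![(1, 0), (0, b)]) p₀ (0, a) +
      fderiv ℝ (fun p => η p ![(1, 0), (0, a)]) p₀ (0, b) := by
    rw [hηclosed] at h
    refine Eq.trans (by rfl) (h.trans ?_)
    refine (s3 _).trans ?_
    rw [r0, r1, r2]
    simp
    ring
  simp only [hηapp] at h'
  -- The velocity form is the contraction `η(∂_t, ·)` restricted to the slice `t = 0`.
  have hα : ∀ a b : F, fderiv ℝ (velocityForm β G) e₀ a b =
      fderiv ℝ (fun p => twoFormBilin E (β (G p)) (fderiv ℝ G p (1, 0))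
        (fderiv ℝ G p (0, b))) p₀ (0, a) := by
    intro a b
    have h1 : HasFDerivAt (fun e => velocityForm β G e b)
        ((fderiv ℝ (velocityForm β G) e₀).flip b) e₀ := by
      have := (differentiableAt_velocityForm hG hβ).hasFDerivAt.clm_apply (hasFDerivAt_const b e₀)
      simpa using this
    have hi : HasFDerivAt (fun e : F => ((0 : ℝ), e)) (ContinuousLinearMap.inr ℝ ℝ F) e₀ :=
      hasFDerivAt_prodMk_right 0 e₀
    have h2 := (hd (1, 0) (0, b)).hasFDerivAt.comp e₀ hi
    exact congrArg (fun T : F →L[ℝ] ℝ => T a) (h1.unique h2)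
  have ht : HasDerivAt (fun t : ℝ => (t, e₀)) ((1 : ℝ), (0 : F)) 0 :=
    (hasDerivAt_id (0 : ℝ)).prodMk (hasDerivAt_const _ _)
  have h3 := (hd (0, a) (0, b)).hasFDerivAt.comp_hasDerivAt (0 : ℝ) ht
  refine h3.congr_deriv ?_
  rw [hα, hα]
  linarith

/-- By the product rule, each of the three terms of the derivative still contains one of the factors
`x 0`, `y 0`. -/
theorem hasDerivAt_bilin_of_eq_zero {B : ℝ → E →L[ℝ] E →L[ℝ] ℝ} {x y : ℝ → E}
    (hB : DifferentiableAt ℝ B 0) (hx : DifferentiableAt ℝ x 0) (hy : DifferentiableAt ℝ y 0)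
    (hx₀ : x 0 = 0) (hy₀ : y 0 = 0) : HasDerivAt (fun t => B t (x t) (y t)) 0 0 := by
  have h1 : HasDerivAt (fun t => B t (x t)) (deriv B 0 (x 0) + B 0 (deriv x 0)) 0 :=
    HasDerivAt.clm_apply (F := E) (G := E →L[ℝ] ℝ) hB.hasDerivAt hx.hasDerivAt
  have h2 := HasDerivAt.clm_apply (F := E) (G := ℝ) h1 hy.hasDerivAt
  refine h2.congr_deriv ?_
  rw [hx₀, hy₀, map_zero, map_zero, zero_apply, add_zero]

/-- Let `u t`, `v t` be orthogonal to the image of the differential at `e₀` of the map `G (t, ·)`,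
and tangent to it at `t = 0`. Then `β (u t, v t)` varies at `t = 0` by minus the exterior derivative
of the velocity form. -/
theorem hasDerivAt_twoForm_of_orthogonal (hG : ContDiffAt ℝ ∞ G (0, e₀))
    (hβ : DifferentiableAt ℝ β (G (0, e₀))) (hclosed : extDeriv β (G (0, e₀)) = 0) {a b : F}
    {u v : ℝ → E} (hu : DifferentiableAt ℝ u 0) (hv : DifferentiableAt ℝ v 0)
    (hu₀ : u 0 = fderiv ℝ G (0, e₀) (0, a)) (hv₀ : v 0 = fderiv ℝ G (0, e₀) (0, b))
    (huo : ∀ᶠ t in 𝓝 (0 : ℝ), ∀ c,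
      twoFormBilin E (β (G (t, e₀))) (u t) (fderiv ℝ G (t, e₀) (0, c)) = 0)
    (hvo : ∀ᶠ t in 𝓝 (0 : ℝ), ∀ c,
      twoFormBilin E (β (G (t, e₀))) (v t) (fderiv ℝ G (t, e₀) (0, c)) = 0) :
    HasDerivAt (fun t => twoFormBilin E (β (G (t, e₀))) (u t) (v t))
      (-(fderiv ℝ (velocityForm β G) e₀ a b - fderiv ℝ (velocityForm β G) e₀ b a)) 0 := by
  have ht : DifferentiableAt ℝ (fun t : ℝ => (t, e₀)) 0 := by fun_prop
  have hG' : DifferentiableAt ℝ (fun t : ℝ => fderiv ℝ G (t, e₀)) 0 :=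
    DifferentiableAt.comp (0 : ℝ) (differentiableAt_fderiv_of_contDiffAt hG) ht
  have hB : DifferentiableAt ℝ (fun t : ℝ => twoFormBilin E (β (G (t, e₀)))) 0 :=
    DifferentiableAt.comp (g := fun p => twoFormBilin E (β (G p))) (0 : ℝ)
      (differentiableAt_twoFormBilin_comp hG hβ) ht
  have hx : ∀ {w : ℝ → E} {c : F}, DifferentiableAt ℝ w 0 →
      DifferentiableAt ℝ (fun t => w t - fderiv ℝ G (t, e₀) (0, c)) 0 := fun hw =>
    hw.sub (hG'.clm_apply (differentiableAt_const _))
  -- Both differences `u - dG a` and `v - dG b` vanish at `t = 0`, so their pairing has zero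
  -- derivative. Expanding it, the terms `β(u, dG b)` and `β(dG a, v)` vanish by orthogonality;
  -- hence `β(u, v)` equals this pairing minus `β(dG a, dG b)`, whose derivative is given by
  -- Cartan's formula.
  have h1 := hasDerivAt_bilin_of_eq_zero hB (hx (c := a) hu) (hx (c := b) hv)
    (by rw [hu₀, sub_self]) (by rw [hv₀, sub_self])
  have h2 := h1.sub (hasDerivAt_pullback_twoForm hG hβ hclosed a b)
  rw [zero_sub] at h2
  refine h2.congr_of_eventuallyEq ?_
  filter_upwards [huo, hvo] with t hut hvt
  have h3 := hut b
  have h4 := hvt a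
  rw [twoFormBilin_swap, neg_eq_zero] at h4
  simp only [Pi.sub_apply, map_sub, sub_apply, h3, h4]
  ring

end FirstVariation

/-! ### Derivatives in charts -/

/-- The derivative of a map between manifolds, as a map between the model spaces. -/
noncomputable def modelDeriv (F : Type*) [NormedAddCommGroup F] [NormedSpace ℝ F]
    (E : Type*) [NormedAddCommGroup E] [NormedSpace ℝ E]
    {X : Type*} [TopologicalSpace X] [ChartedSpace E X]
    {Y : Type*} [TopologicalSpace Y] [ChartedSpace F Y] (f : Y → X) (y : Y) : F →L[ℝ] E :=
  mfderiv 𝓘(ℝ, F) 𝓘(ℝ, E) f y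

section ModelDeriv

variable {E : Type*} [NormedAddCommGroup E] [NormedSpace ℝ E]
  {X : Type*} [TopologicalSpace X] [ChartedSpace E X]
  {F : Type*} [NormedAddCommGroup F] [NormedSpace ℝ F]
  {Y : Type*} [TopologicalSpace Y] [ChartedSpace F Y]

theorem modelDeriv_eq_fderiv (f : F → E) (e : F) : modelDeriv F E f e = fderiv ℝ f e :=
  mfderiv_eq_fderiv

theorem modelDeriv_comp {H : Type*} [NormedAddCommGroup H] [NormedSpace ℝ H]
    {W : Type*} [TopologicalSpace W] [ChartedSpace H W] {g : Y → X} {f : W → Y} (w : W)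
    (hg : MDifferentiableAt 𝓘(ℝ, F) 𝓘(ℝ, E) g (f w))
    (hf : MDifferentiableAt 𝓘(ℝ, H) 𝓘(ℝ, F) f w) :
    modelDeriv H E (fun w => g (f w)) w = (modelDeriv F E g (f w)).comp (modelDeriv H F f w) :=
  mfderiv_comp w hg hf

theorem Filter.EventuallyEq.modelDeriv_eq {f g : Y → X} {y : Y} (h : f =ᶠ[𝓝 y] g) :
    modelDeriv F E f y = modelDeriv F E g y :=
  h.mfderiv_eq

theorem modelDeriv_id (x : X) : modelDeriv E E (fun x : X => x) x = ContinuousLinearMap.id ℝ E :=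
  mfderiv_id

variable [IsManifold 𝓘(ℝ, E) ∞ X]

theorem mdifferentiableAt_chart {x₀ x : X} (hx : x ∈ (extChartAt 𝓘(ℝ, E) x₀).source) :
    MDifferentiableAt 𝓘(ℝ, E) 𝓘(ℝ, E) (extChartAt 𝓘(ℝ, E) x₀) x :=
  (contMDiffAt_extChartAt' (n := ∞) (by simpa using hx)).mdifferentiableAt (by simp)

theorem contMDiffAt_chart_symm {x₀ : X} {e : E} (he : e ∈ (extChartAt 𝓘(ℝ, E) x₀).target) :
    ContMDiffAt 𝓘(ℝ, E) 𝓘(ℝ, E) ∞ (extChartAt 𝓘(ℝ, E) x₀).symm e :=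
  (contMDiffOn_extChartAt_symm x₀ e he).contMDiffAt ((isOpen_extChartAt_target _).mem_nhds he)

theorem mdifferentiableAt_chart_symm {x₀ : X} {e : E}
    (he : e ∈ (extChartAt 𝓘(ℝ, E) x₀).target) :
    MDifferentiableAt 𝓘(ℝ, E) 𝓘(ℝ, E) (extChartAt 𝓘(ℝ, E) x₀).symm e :=
  (contMDiffAt_chart_symm he).mdifferentiableAt (by simp)

theorem modelDeriv_chart_symm_chart {x₀ x : X} (hx : x ∈ (extChartAt 𝓘(ℝ, E) x₀).source) (v : E) :
    modelDeriv E E (extChartAt 𝓘(ℝ, E) x₀).symm (extChartAt 𝓘(ℝ, E) x₀ x)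
      (modelDeriv E E (extChartAt 𝓘(ℝ, E) x₀) x v) = v := by
  have ht := (extChartAt 𝓘(ℝ, E) x₀).map_source hx
  have h := modelDeriv_comp x (mdifferentiableAt_chart_symm ht) (mdifferentiableAt_chart hx)
  have heq : (fun z => (extChartAt 𝓘(ℝ, E) x₀).symm (extChartAt 𝓘(ℝ, E) x₀ z)) =ᶠ[𝓝 x]
      fun z => z := by
    filter_upwards [(isOpen_extChartAt_source (I := 𝓘(ℝ, E)) x₀).mem_nhds hx] with z hz
    exact (extChartAt 𝓘(ℝ, E) x₀).left_inv hz
  rw [heq.modelDeriv_eq, modelDeriv_id] at h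
  exact (congrArg (fun T : E →L[ℝ] E => T v) h).symm

theorem modelDeriv_chart_chart_symm {x₀ : X} {e : E} (he : e ∈ (extChartAt 𝓘(ℝ, E) x₀).target)
    (v : E) :
    modelDeriv E E (extChartAt 𝓘(ℝ, E) x₀) ((extChartAt 𝓘(ℝ, E) x₀).symm e)
      (modelDeriv E E (extChartAt 𝓘(ℝ, E) x₀).symm e v) = v := by
  have hs := (extChartAt 𝓘(ℝ, E) x₀).map_target he
  have h := modelDeriv_comp e (mdifferentiableAt_chart hs) (mdifferentiableAt_chart_symm he)
  have heq : (fun z => extChartAt 𝓘(ℝ, E) x₀ ((extChartAt 𝓘(ℝ, E) x₀).symm z)) =ᶠ[𝓝 e]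
      fun z => z := by
    filter_upwards [(isOpen_extChartAt_target (I := 𝓘(ℝ, E)) x₀).mem_nhds he] with z hz
    exact (extChartAt 𝓘(ℝ, E) x₀).right_inv hz
  rw [heq.modelDeriv_eq, modelDeriv_id] at h
  exact (congrArg (fun T : E →L[ℝ] E => T v) h).symm

theorem modelDeriv_chart_symm_comp {x₀ : X} {f : Y → X} {y : Y}
    (hf : MDifferentiableAt 𝓘(ℝ, F) 𝓘(ℝ, E) f y)
    (hs : f y ∈ (extChartAt 𝓘(ℝ, E) x₀).source) (a : F) :
    modelDeriv E E (extChartAt 𝓘(ℝ, E) x₀).symm (extChartAt 𝓘(ℝ, E) x₀ (f y))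
      (modelDeriv F E (fun z => extChartAt 𝓘(ℝ, E) x₀ (f z)) y a) = modelDeriv F E f y a := by
  rw [modelDeriv_comp y (mdifferentiableAt_chart hs) hf]
  exact modelDeriv_chart_symm_chart hs _

end ModelDeriv

/-! ### Smooth embeddings: local left inverses and injectivity of the differential. -/

section Embedding

variable {E : Type*} [NormedAddCommGroup E] [NormedSpace ℝ E]
  {X : Type*} [TopologicalSpace X] [ChartedSpace E X] [IsManifold 𝓘(ℝ, E) ∞ X]
  {F : Type*} [NormedAddCommGroup F] [NormedSpace ℝ F]
  {Y : Type*} [TopologicalSpace Y] [ChartedSpace F Y] [IsManifold 𝓘(ℝ, F) ∞ Y] {f : Y → X}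

/-- A smooth embedding has smooth local left inverses. -/
theorem Manifold.IsSmoothEmbedding.exists_local_leftInverse
    (hf : Manifold.IsSmoothEmbedding 𝓘(ℝ, F) 𝓘(ℝ, E) ∞ f) (y₀ : Y) :
    ∃ r : X → Y, ∀ᶠ x in 𝓝 (f y₀),
      ContMDiffAt 𝓘(ℝ, E) 𝓘(ℝ, F) ∞ r x ∧ ∀ y, f y = x → r x = y := by
  have h := hf.isImmersion.isImmersionAt y₀
  -- In adapted charts an immersion is `a ↦ (a, 0)`, and `P` reads off the first component.
  set P : E →L[ℝ] F := (ContinuousLinearMap.fst ℝ F h.complement).comp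
    h.equiv.symm.toContinuousLinearMap
  have hsrc : ∀ z ∈ h.domChart.source, P (h.codChart (f z)) = h.domChart z := by
    intro z hz
    have hw := h.writtenInCharts ((h.domChart.extend 𝓘(ℝ, F)).map_source
      (by rwa [OpenPartialHomeomorph.extend_source]))
    have hw' : h.codChart (f z) = h.equiv (h.domChart z, 0) := by
      simpa [h.domChart.left_inv hz] using hw
    simp [P, hw']
  refine ⟨fun x => h.domChart.symm (P (h.codChart x)), ?_⟩
  have h1 : ∀ᶠ x in 𝓝 (f y₀), x ∈ h.codChart.source :=
    h.codChart.open_source.mem_nhds h.mem_codChart_source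
  have h2 : ∀ᶠ x in 𝓝 (f y₀), P (h.codChart x) ∈ h.domChart.target := by
    have hc : ContinuousAt (fun x => P (h.codChart x)) (f y₀) :=
      P.continuous.continuousAt.comp (h.codChart.continuousAt h.mem_codChart_source)
    refine hc.eventually_mem (h.domChart.open_target.mem_nhds ?_)
    rw [hsrc y₀ h.mem_domChart_source]
    exact h.domChart.map_source h.mem_domChart_source
  -- An immersion alone would not suffice: since `Y` carries the induced topology, no distant part
  -- of `Y` is mapped near `f y₀`. Thus `r` recovers every preimage of `x`, not only those near
  -- `y₀`.
  have h3 : ∀ᶠ x in 𝓝 (f y₀), ∀ y, f y = x → y ∈ h.domChart.source := by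
    have h4 := h.domChart.open_source.mem_nhds h.mem_domChart_source
    rw [hf.isEmbedding.nhds_eq_comap] at h4
    exact eventually_comap.1 h4
  filter_upwards [h1, h2, h3] with x hx1 hx2 hx3
  refine ⟨?_, fun y hy => ?_⟩
  · have h5 : ContMDiffAt 𝓘(ℝ, E) 𝓘(ℝ, E) ∞ h.codChart x :=
      contMDiffAt_of_mem_maximalAtlas h.codChart_mem_maximalAtlas hx1
    have h6 : ContMDiffAt 𝓘(ℝ, E) 𝓘(ℝ, F) ∞ (fun x => P (h.codChart x)) x :=
      P.contDiff.contMDiff.contMDiffAt.comp x h5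
    exact ContMDiffAt.comp x
      (contMDiffAt_symm_of_mem_maximalAtlas h.domChart_mem_maximalAtlas hx2) h6
  · rw [← hy, hsrc y (hx3 y hy), h.domChart.left_inv (hx3 y hy)]

/-- The differential of a smooth embedding is injective. -/
theorem Manifold.IsSmoothEmbedding.injective_modelDeriv
    (hf : Manifold.IsSmoothEmbedding 𝓘(ℝ, F) 𝓘(ℝ, E) ∞ f) (y : Y) :
    Function.Injective (modelDeriv F E f y) := by
  obtain ⟨r, hr⟩ := hf.exists_local_leftInverse y
  -- Differentiating `r ∘ f = id` gives a left inverse of the differential.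
  have heq : (fun z => r (f z)) =ᶠ[𝓝 y] fun z => z :=
    (hf.contMDiff.continuous.continuousAt.eventually hr).mono fun z hz => hz.2 z rfl
  have h := modelDeriv_comp (F := E) (E := F) y (hr.self_of_nhds.1.mdifferentiableAt (by simp))
    (hf.contMDiff.mdifferentiable (by simp) y)
  rw [heq.modelDeriv_eq, modelDeriv_id] at h
  exact Function.LeftInverse.injective (g := modelDeriv E F r (f y))
    fun a => (congrArg (fun T : F →L[ℝ] F => T a) h).symm

end Embedding

/-! ### The symplectic form and the submanifold in charts -/

namespace SymplecticForm

variable {E : Type*} [NormedAddCommGroup E] [NormedSpace ℝ E]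
  {X : Type*} [TopologicalSpace X] [ChartedSpace E X]

/-- The symplectic form at `x` as a bilinear form on the model space. -/
noncomputable def bilin (Ω : SymplecticForm E X) (x : X) : E →L[ℝ] E →L[ℝ] ℝ :=
  twoFormBilin E (Ω.form x : E [⋀^Fin 2]→L[ℝ] ℝ)

theorem bilin_apply (Ω : SymplecticForm E X) (x : X) (u v : E) :
    Ω.bilin x u v = Ω.form x ![(u : TangentSpace 𝓘(ℝ, E) x), v] :=
  twoFormBilin_apply _ u v

theorem eq_zero_of_bilin_eq_zero (Ω : SymplecticForm E X) (x : X) (u : E)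
    (h : ∀ w, Ω.bilin x u w = 0) : u = 0 :=
  Ω.nondegenerate x u fun w => (Ω.bilin_apply x u w).symm.trans (h w)

theorem twoFormBilin_inChart (Ω : SymplecticForm E X) (x₀ : X) (e a b : E) :
    twoFormBilin E (twoFormInChart Ω.form x₀ e) a b =
      Ω.bilin ((extChartAt 𝓘(ℝ, E) x₀).symm e)
        (modelDeriv E E (extChartAt 𝓘(ℝ, E) x₀).symm e a)
        (modelDeriv E E (extChartAt 𝓘(ℝ, E) x₀).symm e b) := by
  rw [twoFormBilin_apply, bilin_apply]
  refine congrArg (Ω.form ((extChartAt 𝓘(ℝ, E) x₀).symm e)) ?_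
  funext i
  fin_cases i <;> rfl

theorem contDiffAt_inChart (Ω : SymplecticForm E X) {x₀ : X} {e : E}
    (he : e ∈ (extChartAt 𝓘(ℝ, E) x₀).target) :
    ContDiffAt ℝ ∞ (twoFormInChart Ω.form x₀) e :=
  (Ω.smooth x₀).contDiffAt ((isOpen_extChartAt_target _).mem_nhds he)

variable [IsManifold 𝓘(ℝ, E) ∞ X]

theorem twoFormBilin_inChart_chart (Ω : SymplecticForm E X) {x₀ x : X}
    (hx : x ∈ (extChartAt 𝓘(ℝ, E) x₀).source) (a b : E) :
    twoFormBilin E (twoFormInChart Ω.form x₀ (extChartAt 𝓘(ℝ, E) x₀ x))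
        (modelDeriv E E (extChartAt 𝓘(ℝ, E) x₀) x a)
        (modelDeriv E E (extChartAt 𝓘(ℝ, E) x₀) x b) = Ω.bilin x a b := by
  rw [twoFormBilin_inChart, modelDeriv_chart_symm_chart hx, modelDeriv_chart_symm_chart hx,
    (extChartAt 𝓘(ℝ, E) x₀).left_inv hx]

/-- Nondegeneracy transfers because the differential of the inverse chart is bijective. -/
theorem inChart_nondegenerate (Ω : SymplecticForm E X) {x₀ : X} {e : E}
    (he : e ∈ (extChartAt 𝓘(ℝ, E) x₀).target) (u : E)
    (h : ∀ w, twoFormBilin E (twoFormInChart Ω.form x₀ e) u w = 0) : u = 0 := by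
  have hu : modelDeriv E E (extChartAt 𝓘(ℝ, E) x₀).symm e u = 0 := by
    refine Ω.eq_zero_of_bilin_eq_zero ((extChartAt 𝓘(ℝ, E) x₀).symm e) _ fun w => ?_
    have hs := (extChartAt 𝓘(ℝ, E) x₀).map_target he
    have h1 := h (modelDeriv E E (extChartAt 𝓘(ℝ, E) x₀) ((extChartAt 𝓘(ℝ, E) x₀).symm e) w)
    have h2 := modelDeriv_chart_symm_chart hs w
    rw [(extChartAt 𝓘(ℝ, E) x₀).right_inv he] at h2
    rwa [twoFormBilin_inChart, h2] at h1
  have h3 := modelDeriv_chart_chart_symm he u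
  rw [hu, map_zero] at h3
  exact h3.symm

end SymplecticForm

namespace CoisotropicSubmanifold

variable {E : Type*} [NormedAddCommGroup E] [NormedSpace ℝ E]
  {X : Type*} [TopologicalSpace X] [ChartedSpace E X] {Ω : SymplecticForm E X}
  {F : Type*} [NormedAddCommGroup F] [NormedSpace ℝ F]
  {Y : Type*} [TopologicalSpace Y] [ChartedSpace F Y]

/-- The fibre of the characteristic distribution as a subspace of the model space. -/
noncomputable def nullSpace (S : CoisotropicSubmanifold Ω F Y) (y : Y) : Submodule ℝ F :=
  S.nullDistribution y

theorem mem_nullSpace (S : CoisotropicSubmanifold Ω F Y) (y : Y) (v : F) :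
    v ∈ S.nullSpace y ↔ ∀ w : F,
      Ω.bilin (S.incl y) (modelDeriv F E S.incl y v) (modelDeriv F E S.incl y w) = 0 :=
  (S.mem_nullDistribution y v).trans
    (forall_congr' fun w => by rw [SymplecticForm.bilin_apply]; rfl)

/-- Every later use of the coisotropy condition passes through this form of it. -/
theorem exists_tangent_of_orthogonal (S : CoisotropicSubmanifold Ω F Y) (y : Y) (u : E)
    (hu : ∀ w : F, Ω.bilin (S.incl y) u (modelDeriv F E S.incl y w) = 0) :
    ∃ v : F, modelDeriv F E S.incl y v = u := by
  refine S.coisotropic y (x := u) ?_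
  rintro _ ⟨w, rfl⟩
  exact (SymplecticForm.bilin_apply _ _ _ _).symm.trans (hu w)

/-- The inclusion of `Y` in the charts around `y₀` and its image. -/
noncomputable def chartIncl (S : CoisotropicSubmanifold Ω F Y) (y₀ : Y) (e : F) : E :=
  extChartAt 𝓘(ℝ, E) (S.incl y₀) (S.incl ((extChartAt 𝓘(ℝ, F) y₀).symm e))

/-- The set of parameters at which the inclusion is represented by `chartIncl`. -/
def chartDomain (S : CoisotropicSubmanifold Ω F Y) (y₀ : Y) : Set F :=
  (extChartAt 𝓘(ℝ, F) y₀).target ∩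
    {e | S.incl ((extChartAt 𝓘(ℝ, F) y₀).symm e) ∈ (extChartAt 𝓘(ℝ, E) (S.incl y₀)).source}

/-- The symplectic form along `Y` in the charts around `y₀` and its image. -/
noncomputable def chartBilin (S : CoisotropicSubmanifold Ω F Y) (y₀ : Y) (e : F) :
    E →L[ℝ] E →L[ℝ] ℝ :=
  twoFormBilin E (twoFormInChart Ω.form (S.incl y₀) (S.chartIncl y₀ e))

variable [IsManifold 𝓘(ℝ, F) ∞ Y] [IsManifold 𝓘(ℝ, E) ∞ X]

theorem contMDiff_incl (S : CoisotropicSubmanifold Ω F Y) :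
    ContMDiff 𝓘(ℝ, F) 𝓘(ℝ, E) ∞ S.incl :=
  S.isSmoothEmbedding.contMDiff

theorem mdifferentiableAt_incl (S : CoisotropicSubmanifold Ω F Y) (y : Y) :
    MDifferentiableAt 𝓘(ℝ, F) 𝓘(ℝ, E) S.incl y :=
  S.contMDiff_incl.mdifferentiable (by simp) y

variable (S : CoisotropicSubmanifold Ω F Y) {y₀ : Y} {e : F}

theorem injective_modelDeriv_incl (y : Y) : Function.Injective (modelDeriv F E S.incl y) :=
  S.isSmoothEmbedding.injective_modelDeriv y

theorem isOpen_chartDomain (y₀ : Y) : IsOpen (S.chartDomain y₀) := by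
  refine ContinuousOn.isOpen_inter_preimage ?_ (isOpen_extChartAt_target y₀)
    (isOpen_extChartAt_source (I := 𝓘(ℝ, E)) (S.incl y₀))
  exact S.contMDiff_incl.continuous.comp_continuousOn (continuousOn_extChartAt_symm y₀)

theorem chart_mem_chartDomain (y₀ : Y) : extChartAt 𝓘(ℝ, F) y₀ y₀ ∈ S.chartDomain y₀ := by
  refine ⟨mem_extChartAt_target y₀, ?_⟩
  rw [mem_ofPred_eq, extChartAt_to_inv]
  exact mem_extChartAt_source _

theorem chartDomain_mem_nhds (y₀ : Y) : S.chartDomain y₀ ∈ 𝓝 (extChartAt 𝓘(ℝ, F) y₀ y₀) :=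
  (S.isOpen_chartDomain y₀).mem_nhds (S.chart_mem_chartDomain y₀)

theorem chartIncl_mem_target (he : e ∈ S.chartDomain y₀) :
    S.chartIncl y₀ e ∈ (extChartAt 𝓘(ℝ, E) (S.incl y₀)).target :=
  (extChartAt 𝓘(ℝ, E) (S.incl y₀)).map_source he.2

theorem chart_symm_chartIncl (he : e ∈ S.chartDomain y₀) :
    (extChartAt 𝓘(ℝ, E) (S.incl y₀)).symm (S.chartIncl y₀ e) =
      S.incl ((extChartAt 𝓘(ℝ, F) y₀).symm e) :=
  (extChartAt 𝓘(ℝ, E) (S.incl y₀)).left_inv he.2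

theorem contDiffAt_chartIncl (he : e ∈ S.chartDomain y₀) : ContDiffAt ℝ ∞ (S.chartIncl y₀) e := by
  have h1 : ContMDiffAt 𝓘(ℝ, F) 𝓘(ℝ, E) ∞
      (fun e => S.incl ((extChartAt 𝓘(ℝ, F) y₀).symm e)) e :=
    (S.contMDiff_incl.contMDiffAt).comp e (contMDiffAt_chart_symm he.1)
  have h2 : ContMDiffAt 𝓘(ℝ, E) 𝓘(ℝ, E) ∞ (extChartAt 𝓘(ℝ, E) (S.incl y₀))
      (S.incl ((extChartAt 𝓘(ℝ, F) y₀).symm e)) :=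
    contMDiffAt_extChartAt' (by simpa using he.2)
  exact (h2.comp e h1).contDiffAt

theorem contDiffAt_chartBilin (he : e ∈ S.chartDomain y₀) :
    ContDiffAt ℝ ∞ (S.chartBilin y₀) e :=
  contDiff_twoFormBilin.contDiffAt.comp e
    ((Ω.contDiffAt_inChart (S.chartIncl_mem_target he)).comp e (S.contDiffAt_chartIncl he))

theorem chart_symm_fderiv_chartIncl (he : e ∈ S.chartDomain y₀) (a : F) :
    modelDeriv E E (extChartAt 𝓘(ℝ, E) (S.incl y₀)).symm (S.chartIncl y₀ e)
        (fderiv ℝ (S.chartIncl y₀) e a) =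
      modelDeriv F E S.incl ((extChartAt 𝓘(ℝ, F) y₀).symm e)
        (modelDeriv F F (extChartAt 𝓘(ℝ, F) y₀).symm e a) := by
  have h1 := mdifferentiableAt_chart_symm he.1
  have h2 := S.mdifferentiableAt_incl ((extChartAt 𝓘(ℝ, F) y₀).symm e)
  have h3 := modelDeriv_chart_symm_comp (h2.comp e h1) he.2 a
  have h4 := modelDeriv_comp (E := E) e h2 h1
  rw [← modelDeriv_eq_fderiv]
  exact h3.trans (congrArg (fun T : F →L[ℝ] E => T a) h4)

theorem chartBilin_fderiv (he : e ∈ S.chartDomain y₀) (u : E) (a : F) :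
    S.chartBilin y₀ e u (fderiv ℝ (S.chartIncl y₀) e a) =
      Ω.bilin (S.incl ((extChartAt 𝓘(ℝ, F) y₀).symm e))
        (modelDeriv E E (extChartAt 𝓘(ℝ, E) (S.incl y₀)).symm (S.chartIncl y₀ e) u)
        (modelDeriv F E S.incl ((extChartAt 𝓘(ℝ, F) y₀).symm e)
          (modelDeriv F F (extChartAt 𝓘(ℝ, F) y₀).symm e a)) := by
  rw [chartBilin, SymplecticForm.twoFormBilin_inChart, S.chart_symm_chartIncl he,
    S.chart_symm_fderiv_chartIncl he]

theorem chartBilin_nondegenerate (he : e ∈ S.chartDomain y₀) (u : E)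
    (h : ∀ w, S.chartBilin y₀ e u w = 0) : u = 0 :=
  Ω.inChart_nondegenerate (S.chartIncl_mem_target he) u h

theorem modelDeriv_chart_symm_surjective (he : e ∈ (extChartAt 𝓘(ℝ, F) y₀).target) (w : F) :
    ∃ a, modelDeriv F F (extChartAt 𝓘(ℝ, F) y₀).symm e a = w := by
  have h := modelDeriv_chart_symm_chart ((extChartAt 𝓘(ℝ, F) y₀).map_target he) w
  rw [(extChartAt 𝓘(ℝ, F) y₀).right_inv he] at h
  exact ⟨_, h⟩

theorem injective_fderiv_chartIncl (he : e ∈ S.chartDomain y₀) :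
    Function.Injective (fderiv ℝ (S.chartIncl y₀) e) := by
  refine (injective_iff_map_eq_zero _).2 fun a ha => ?_
  have h1 := S.chart_symm_fderiv_chartIncl he a
  rw [ha, map_zero] at h1
  have h2 := (injective_iff_map_eq_zero _).1 (S.injective_modelDeriv_incl _) _ h1.symm
  have h3 := modelDeriv_chart_chart_symm he.1 a
  rw [h2, map_zero] at h3
  exact h3.symm

theorem mem_nullSpace_chart (he : e ∈ S.chartDomain y₀) (a : F) :
    modelDeriv F F (extChartAt 𝓘(ℝ, F) y₀).symm e a ∈
        S.nullSpace ((extChartAt 𝓘(ℝ, F) y₀).symm e) ↔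
      ∀ b, S.chartBilin y₀ e (fderiv ℝ (S.chartIncl y₀) e a) (fderiv ℝ (S.chartIncl y₀) e b) = 0 := by
  rw [mem_nullSpace]
  constructor
  · intro h b
    rw [S.chartBilin_fderiv he, S.chart_symm_fderiv_chartIncl he]
    exact h _
  · intro h w
    obtain ⟨b, rfl⟩ := modelDeriv_chart_symm_surjective he.1 w
    rw [← S.chart_symm_fderiv_chartIncl he, ← S.chartBilin_fderiv he]
    exact h b

/-- Coisotropy read in charts: the orthogonal of the coordinate tangent space is contained in that
tangent space. -/
theorem exists_fderiv_eq_of_orthogonal (he : e ∈ S.chartDomain y₀) (u : E)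
    (hu : ∀ a, S.chartBilin y₀ e u (fderiv ℝ (S.chartIncl y₀) e a) = 0) :
    ∃ a, fderiv ℝ (S.chartIncl y₀) e a = u := by
  obtain ⟨v, hv⟩ := S.exists_tangent_of_orthogonal ((extChartAt 𝓘(ℝ, F) y₀).symm e)
    (modelDeriv E E (extChartAt 𝓘(ℝ, E) (S.incl y₀)).symm (S.chartIncl y₀ e) u) (by
      intro w
      obtain ⟨b, rfl⟩ := modelDeriv_chart_symm_surjective he.1 w
      rw [← S.chartBilin_fderiv he]
      exact hu b)
  obtain ⟨a, rfl⟩ := modelDeriv_chart_symm_surjective he.1 v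
  rw [← S.chart_symm_fderiv_chartIncl he] at hv
  refine ⟨a, ?_⟩
  have h1 := modelDeriv_chart_chart_symm (S.chartIncl_mem_target he)
    (fderiv ℝ (S.chartIncl y₀) e a)
  rw [hv, modelDeriv_chart_chart_symm (S.chartIncl_mem_target he)] at h1
  exact h1.symm

end CoisotropicSubmanifold

/-! ### Leafwise vector fields and the leafwise differential in charts -/

section TangentMaps

variable {E : Type*} [NormedAddCommGroup E] [NormedSpace ℝ E]
  {X : Type*} [TopologicalSpace X] [ChartedSpace E X] [IsManifold 𝓘(ℝ, E) ∞ X]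
  {F : Type*} [NormedAddCommGroup F] [NormedSpace ℝ F]
  {Y : Type*} [TopologicalSpace Y] [ChartedSpace F Y] [IsManifold 𝓘(ℝ, F) ∞ Y]

theorem contMDiffOn_tangentMap {f : Y → X} {U : Set Y} (hU : IsOpen U)
    (hf : ContMDiffOn 𝓘(ℝ, F) 𝓘(ℝ, E) ∞ f U) :
    ContMDiffOn 𝓘(ℝ, F).tangent 𝓘(ℝ, E).tangent ∞ (tangentMap 𝓘(ℝ, F) 𝓘(ℝ, E) f)
      {p : TangentBundle 𝓘(ℝ, F) Y | p.proj ∈ U} := by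
  refine (hf.contMDiffOn_tangentMapWithin (m := ∞) (by simp) hU.uniqueMDiffOn).congr ?_
  intro p hp
  exact (tangentMapWithin_eq_tangentMap (hU.uniqueMDiffOn _ hp)
    ((hf.contMDiffAt (hU.mem_nhds hp)).mdifferentiableAt (by simp))).symm

theorem tangentBundle_mk_eq {y z : Y} (h : z = y) (v : F) :
    (⟨z, v⟩ : TangentBundle 𝓘(ℝ, F) Y) = ⟨y, v⟩ := by
  rw [h]

/-- A smooth vector field on the model space defines a smooth vector field on the domain of a
chart. -/
theorem contMDiffOn_chart_field {y₀ : Y} {s : F → F} {N : Set F}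
    (hs : ContDiffOn ℝ ∞ s N) :
    ContMDiffOn 𝓘(ℝ, F) 𝓘(ℝ, F).tangent ∞
      (fun y => (⟨y, modelDeriv F F (extChartAt 𝓘(ℝ, F) y₀).symm (extChartAt 𝓘(ℝ, F) y₀ y)
        (s (extChartAt 𝓘(ℝ, F) y₀ y))⟩ : TangentBundle 𝓘(ℝ, F) Y))
      ((extChartAt 𝓘(ℝ, F) y₀).source ∩ extChartAt 𝓘(ℝ, F) y₀ ⁻¹' N) := by
  have h1 : ContMDiffOn 𝓘(ℝ, F) 𝓘(ℝ, F).tangent ∞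
      (fun e => (⟨e, s e⟩ : TangentBundle 𝓘(ℝ, F) F)) N :=
    contMDiffOn_vectorSpace_iff_contDiffOn.2 hs
  have h2 : ContMDiffOn 𝓘(ℝ, F) 𝓘(ℝ, F) ∞ (extChartAt 𝓘(ℝ, F) y₀)
      (extChartAt 𝓘(ℝ, F) y₀).source :=
    fun y hy => (contMDiffAt_extChartAt' (by simpa using hy)).contMDiffWithinAt
  have h3 := contMDiffOn_tangentMap (isOpen_extChartAt_target (I := 𝓘(ℝ, F)) y₀)
    (contMDiffOn_extChartAt_symm (n := ∞) y₀)
  have h4 := h3.comp (h1.comp (h2.mono inter_subset_left) (fun y hy => hy.2))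
    (fun y hy => (extChartAt 𝓘(ℝ, F) y₀).map_source hy.1)
  exact h4.congr fun y hy =>
    (tangentBundle_mk_eq ((extChartAt 𝓘(ℝ, F) y₀).left_inv hy.1) _).symm

end TangentMaps

namespace CoisotropicSubmanifold

variable {E : Type*} [NormedAddCommGroup E] [NormedSpace ℝ E]
  {X : Type*} [TopologicalSpace X] [ChartedSpace E X] {Ω : SymplecticForm E X}
  {F : Type*} [NormedAddCommGroup F] [NormedSpace ℝ F]
  {Y : Type*} [TopologicalSpace Y] [ChartedSpace F Y]
  [IsManifold 𝓘(ℝ, F) ∞ Y] [IsManifold 𝓘(ℝ, E) ∞ X] [FiniteDimensional ℝ F]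
  {S : CoisotropicSubmanifold Ω F Y}

/-- A section of the null distribution given in a chart extends, after shrinking, to a leafwise
vector field. -/
theorem exists_leafwiseVectorField_eventuallyEq [T2Space Y] (y₀ : Y) {s : F → F}
    (hs : ∀ᶠ e in 𝓝 (extChartAt 𝓘(ℝ, F) y₀ y₀), ContDiffAt ℝ ∞ s e)
    (hmem : ∀ᶠ e in 𝓝 (extChartAt 𝓘(ℝ, F) y₀ y₀),
      modelDeriv F F (extChartAt 𝓘(ℝ, F) y₀).symm e (s e) ∈
        S.nullSpace ((extChartAt 𝓘(ℝ, F) y₀).symm e)) :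
    ∃ σ : S.LeafwiseVectorField, ∀ᶠ y in 𝓝 y₀, σ.field y =
      modelDeriv F F (extChartAt 𝓘(ℝ, F) y₀).symm (extChartAt 𝓘(ℝ, F) y₀ y)
        (s (extChartAt 𝓘(ℝ, F) y₀ y)) := by
  obtain ⟨N, hN, hNo, hNm⟩ := eventually_nhds_iff.1 (hs.and hmem)
  set U : Set Y := (extChartAt 𝓘(ℝ, F) y₀).source ∩ extChartAt 𝓘(ℝ, F) y₀ ⁻¹' N with hU
  have hUo : IsOpen U :=
    (continuousOn_extChartAt y₀).isOpen_inter_preimage (isOpen_extChartAt_source y₀) hNo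
  have hyU : y₀ ∈ U := ⟨mem_extChartAt_source y₀, hNm⟩
  -- A bump function with closed support inside `U` makes extension by zero smooth. It equals one
  -- near `y₀`, so the germ of the section is unchanged, and scaling keeps the values in the null
  -- distribution.
  obtain ⟨f, -, hf⟩ := (SmoothBumpFunction.nhds_basis_tsupport (I := 𝓘(ℝ, F)) y₀).mem_iff.1
    (hUo.mem_nhds hyU)
  set w : Y → F := fun y => modelDeriv F F (extChartAt 𝓘(ℝ, F) y₀).symm (extChartAt 𝓘(ℝ, F) y₀ y)
        (s (extChartAt 𝓘(ℝ, F) y₀ y)) with hw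
  have hwU : ∀ y ∈ U, w y ∈ S.nullSpace y := by
    intro y hy
    have h := (hN _ hy.2).2
    rwa [(extChartAt 𝓘(ℝ, F) y₀).left_inv hy.1] at h
  have hsm := contMDiffOn_chart_field (Y := Y) (y₀ := y₀)
    (fun e he => (hN e he).1.contDiffWithinAt)
  let W : ∀ y : Y, TangentSpace 𝓘(ℝ, F) y := w
  refine ⟨⟨⇑f • W, ContMDiffOn.smul_section_of_tsupport f.contMDiff.contMDiffOn hUo hf hsm, ?_⟩, ?_⟩
  · intro y
    by_cases hy : y ∈ U
    · exact (S.nullDistribution y).smul_mem (f y) (hwU y hy)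
    · have h0 : f y = 0 := image_eq_zero_of_notMem_tsupport fun h => hy (hf h)
      have h1 : (⇑f • W) y = 0 := by
        change f y • W y = 0
        rw [h0, zero_smul]
      rw [h1]
      exact zero_mem _
  · filter_upwards [f.eventuallyEq_one] with y hy
    change f y • w y = w y
    rw [hy, Pi.one_apply, one_smul]

open VectorField in
/-- Leafwise vector fields in a chart, and the chart expression of their Lie bracket. -/
theorem exists_chart_leafwiseVectorField (σ τ : S.LeafwiseVectorField) (y : Y) :
    ∃ A B : F → F, DifferentiableAt ℝ A (extChartAt 𝓘(ℝ, F) y y) ∧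
      DifferentiableAt ℝ B (extChartAt 𝓘(ℝ, F) y y) ∧
      (∀ e ∈ (extChartAt 𝓘(ℝ, F) y).target, modelDeriv F F (extChartAt 𝓘(ℝ, F) y).symm e (A e) =
        σ.field ((extChartAt 𝓘(ℝ, F) y).symm e)) ∧
      (∀ e ∈ (extChartAt 𝓘(ℝ, F) y).target, modelDeriv F F (extChartAt 𝓘(ℝ, F) y).symm e (B e) =
        τ.field ((extChartAt 𝓘(ℝ, F) y).symm e)) ∧
      modelDeriv F F (extChartAt 𝓘(ℝ, F) y).symm (extChartAt 𝓘(ℝ, F) y y)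
        (lieBracket ℝ A B (extChartAt 𝓘(ℝ, F) y y)) =
          mlieBracket 𝓘(ℝ, F) σ.field τ.field y := by
  have : CompleteSpace F := FiniteDimensional.complete ℝ F
  -- The chart expression of a field is its pullback by the inverse chart. The bracket on the
  -- manifold is defined by bracketing these expressions in the model space and transporting the
  -- result back.
  obtain ⟨hat, hhat⟩ : ∃ hat : S.LeafwiseVectorField → F → F, ∀ V, hat V =
      mpullbackWithin 𝓘(ℝ, F) 𝓘(ℝ, F) (extChartAt 𝓘(ℝ, F) y).symm V.field (range 𝓘(ℝ, F)) :=
    ⟨_, fun _ => rfl⟩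
  have hpull : ∀ (V : S.LeafwiseVectorField) (e : F), e ∈ (extChartAt 𝓘(ℝ, F) y).target →
      modelDeriv F F (extChartAt 𝓘(ℝ, F) y).symm e (hat V e) =
          V.field ((extChartAt 𝓘(ℝ, F) y).symm e) := by
    intro V e he
    have h := isInvertible_mfderivWithin_extChartAt_symm (I := 𝓘(ℝ, F)) (x := y) he
    have h' := h.self_apply_inverse (V.field ((extChartAt 𝓘(ℝ, F) y).symm e))
    rw [hhat, mpullbackWithin_apply]
    rw [ModelWithCorners.range_eq_univ, mfderivWithin_univ] at h' ⊢
    exact h'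
  have hdiff : ∀ V : S.LeafwiseVectorField,
      DifferentiableAt ℝ (hat V) (extChartAt 𝓘(ℝ, F) y y) := by
    intro V
    have h := MDifferentiableWithinAt.differentiableWithinAt_mpullbackWithin_vectorField
      (I := 𝓘(ℝ, F)) (s := univ) (x := y) (V := V.field)
      ((V.smooth.mdifferentiable (by simp)) y).mdifferentiableWithinAt
    rw [← hhat V, ModelWithCorners.range_eq_univ, preimage_univ, inter_univ] at h
    exact differentiableWithinAt_univ.1 h
  refine ⟨hat σ, hat τ, hdiff σ, hdiff τ, hpull σ, hpull τ, ?_⟩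
  have hysrc : y ∈ (extChartAt 𝓘(ℝ, F) y).source := mem_extChartAt_source y
  obtain ⟨L, hL⟩ : ∃ L : F, L = lieBracket ℝ (hat σ) (hat τ) (extChartAt 𝓘(ℝ, F) y y) := ⟨_, rfl⟩
  have h1 := mlieBracketWithin_apply (I := 𝓘(ℝ, F)) (V := σ.field) (W := τ.field)
    (s := univ) (x₀ := y)
  rw [mlieBracketWithin_univ, ← hhat σ, ← hhat τ, preimage_univ, univ_inter,
    ModelWithCorners.range_eq_univ] at h1
  have h2 := (isInvertible_mfderiv_extChartAt (I := 𝓘(ℝ, F)) hysrc).self_apply_inverse L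
  have h3 : mlieBracket 𝓘(ℝ, F) σ.field τ.field y =
      (mfderiv 𝓘(ℝ, F) 𝓘(ℝ, F) (extChartAt 𝓘(ℝ, F) y) y).inverse L := by
    rw [h1, hL, ← lieBracketWithin_univ]
  rw [← h3] at h2
  have h4 := modelDeriv_chart_symm_chart hysrc (mlieBracket 𝓘(ℝ, F) σ.field τ.field y)
  rw [← hL]
  refine Eq.trans ?_ h4
  exact congrArg (modelDeriv F F (extChartAt 𝓘(ℝ, F) y).symm (extChartAt 𝓘(ℝ, F) y y)) h2.symm

open VectorField in
/-- The leafwise differential of a leafwise `1`-form represented by `α` in a chart. -/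
theorem d₁_eq_of_chart (ξ : S.LeafwiseOneForm) (σ τ : S.LeafwiseVectorField) (y : Y)
    {α : F → F →L[ℝ] ℝ} (hα : DifferentiableAt ℝ α (extChartAt 𝓘(ℝ, F) y y))
    (hξ : ∀ᶠ e in 𝓝 (extChartAt 𝓘(ℝ, F) y y),
      ∀ (w : S.nullDistribution ((extChartAt 𝓘(ℝ, F) y).symm e)) (a : F),
        modelDeriv F F (extChartAt 𝓘(ℝ, F) y).symm e a = w.1 → ξ.1 _ w = α e a)
    {a b : F}
    (ha : modelDeriv F F (extChartAt 𝓘(ℝ, F) y).symm (extChartAt 𝓘(ℝ, F) y y) a = σ.field y)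
    (hb : modelDeriv F F (extChartAt 𝓘(ℝ, F) y).symm (extChartAt 𝓘(ℝ, F) y y) b = τ.field y) :
    S.d₁ ξ σ τ y = fderiv ℝ α (extChartAt 𝓘(ℝ, F) y y) a b
      - fderiv ℝ α (extChartAt 𝓘(ℝ, F) y y) b a := by
  obtain ⟨A, B, hA, hB, hAf, hBf, hbr⟩ := exists_chart_leafwiseVectorField σ τ y
  set e₀ := extChartAt 𝓘(ℝ, F) y y with he₀
  have htgt : e₀ ∈ (extChartAt 𝓘(ℝ, F) y).target := mem_extChartAt_target y
  have hy : (extChartAt 𝓘(ℝ, F) y).symm e₀ = y := extChartAt_to_inv y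
  have hat : ∀ z : Y, (extChartAt 𝓘(ℝ, F) y).symm e₀ = z → ∀ (w : S.nullDistribution z) (a : F),
      modelDeriv F F (extChartAt 𝓘(ℝ, F) y).symm e₀ a = w.1 → ξ.1 z w = α e₀ a := by
    rintro _ rfl
    exact hξ.self_of_nhds
  have hinj : ∀ {u v : F}, modelDeriv F F (extChartAt 𝓘(ℝ, F) y).symm e₀ u =
      modelDeriv F F (extChartAt 𝓘(ℝ, F) y).symm e₀ v → u = v := by
    intro u v h
    rw [← modelDeriv_chart_chart_symm htgt u, h, modelDeriv_chart_chart_symm htgt v]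
  have hfield : ∀ (V : S.LeafwiseVectorField) (z : Y), z = y → (V.field z : F) = V.field y := by
    rintro V _ rfl
    rfl
  have haA : a = A e₀ := hinj (by rw [ha, hAf e₀ htgt]; exact (hfield σ _ hy).symm)
  have hbB : b = B e₀ := hinj (by rw [hb, hBf e₀ htgt]; exact (hfield τ _ hy).symm)
  -- Near the centre `ξ(V)` reads `α e (C e)`, although `α` represents `ξ` only on null vectors. The
  -- product rule gives its derivative along `c`.
  have heval : ∀ (V : S.LeafwiseVectorField) (C : F → F), DifferentiableAt ℝ C e₀ →
      (∀ e ∈ (extChartAt 𝓘(ℝ, F) y).target, modelDeriv F F (extChartAt 𝓘(ℝ, F) y).symm e (C e) =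
        V.field ((extChartAt 𝓘(ℝ, F) y).symm e)) → ∀ (c : F) (v : TangentSpace 𝓘(ℝ, F) y),
      modelDeriv F F (extChartAt 𝓘(ℝ, F) y).symm e₀ c = v →
      derivAlong (eval ξ V) v = fderiv ℝ α e₀ c (C e₀) + α e₀ (fderiv ℝ C e₀ c) := by
    intro V C hC hCf c v hc
    have hsm : MDifferentiableAt 𝓘(ℝ, F) 𝓘(ℝ, ℝ) (eval ξ V) ((extChartAt 𝓘(ℝ, F) y).symm e₀) :=
      (ξ.2 V).mdifferentiable (by simp) _
    have h1 := modelDeriv_comp (E := ℝ) e₀ hsm (mdifferentiableAt_chart_symm htgt)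
    have h2 : (fun e => eval ξ V ((extChartAt 𝓘(ℝ, F) y).symm e)) =ᶠ[𝓝 e₀]
        fun e => α e (C e) := by
      filter_upwards [hξ, (isOpen_extChartAt_target (I := 𝓘(ℝ, F)) y).mem_nhds htgt] with e he het
      exact he ⟨_, V.mem _⟩ (C e) (hCf e het)
    rw [h2.modelDeriv_eq, modelDeriv_eq_fderiv, hy] at h1
    have h3 := (hα.hasFDerivAt.clm_apply hC.hasFDerivAt).fderiv
    rw [h3] at h1
    have h4 := congrArg (fun T : F →L[ℝ] ℝ => T c) h1
    have h5 : modelDeriv F ℝ (eval ξ V) y (modelDeriv F F (extChartAt 𝓘(ℝ, F) y).symm e₀ c) =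
        derivAlong (eval ξ V) v := by
      rw [hc]
      rfl
    refine (h5.symm.trans h4.symm).trans ?_
    simp [add_comm]
  have hd : S.d₁ ξ σ τ y = derivAlong (eval ξ τ) (σ.field y) - derivAlong (eval ξ σ) (τ.field y)
      - ξ.1 y ⟨mlieBracket 𝓘(ℝ, F) σ.field τ.field y, S.mlieBracket_mem σ τ y⟩ := rfl
  -- The terms `α(DB a) - α(DA b)` are `α([A, B])` and cancel `ξ([σ, τ])`. Only the antisymmetrized
  -- derivative of `α` remains.
  rw [hd, heval τ B hB hBf a _ ha, heval σ A hA hAf b _ hb, hat y hy _ _ hbr, lieBracket,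
    haA, hbB, map_sub]
  ring

end CoisotropicSubmanifold

/-! ### Leafwise frames -/

namespace CoisotropicSubmanifold

variable {E : Type*} [NormedAddCommGroup E] [NormedSpace ℝ E] [FiniteDimensional ℝ E]
  {X : Type*} [TopologicalSpace X] [ChartedSpace E X] {Ω : SymplecticForm E X}
  {F : Type*} [NormedAddCommGroup F] [NormedSpace ℝ F] [FiniteDimensional ℝ F]
  {Y : Type*} [TopologicalSpace Y] [ChartedSpace F Y]
  [IsManifold 𝓘(ℝ, F) ∞ Y] [IsManifold 𝓘(ℝ, E) ∞ X]

/-- The null distribution is locally spanned by the smooth sections `c γ`, which in the chart are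
the vectors dual to the restrictions of the functionals `γ` to a complement of `TY`. -/
theorem exists_chart_frame (S : CoisotropicSubmanifold Ω F Y) (y₀ : Y) :
    ∃ c : F → (E →L[ℝ] ℝ) →L[ℝ] F,
      (∀ᶠ e in 𝓝 (extChartAt 𝓘(ℝ, F) y₀ y₀), ContDiffAt ℝ ∞ c e) ∧
      ∀ᶠ e in 𝓝 (extChartAt 𝓘(ℝ, F) y₀ y₀),
        (∀ γ, modelDeriv F F (extChartAt 𝓘(ℝ, F) y₀).symm e (c e γ) ∈
          S.nullSpace ((extChartAt 𝓘(ℝ, F) y₀).symm e)) ∧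
        ∀ a, modelDeriv F F (extChartAt 𝓘(ℝ, F) y₀).symm e a ∈
            S.nullSpace ((extChartAt 𝓘(ℝ, F) y₀).symm e) →
          c e (S.chartBilin y₀ e (fderiv ℝ (S.chartIncl y₀) e a)) = a := by
  have hdom := S.chartDomain_mem_nhds y₀
  have hL : ∀ᶠ e in 𝓝 (extChartAt 𝓘(ℝ, F) y₀ y₀),
      ContDiffAt ℝ ∞ (fderiv ℝ (S.chartIncl y₀)) e := by
    filter_upwards [hdom] with e he
    exact (S.contDiffAt_chartIncl he).fderiv_right (m := ∞) (by simp)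
  have hB : ∀ᶠ e in 𝓝 (extChartAt 𝓘(ℝ, F) y₀ y₀), ContDiffAt ℝ ∞ (S.chartBilin y₀) e := by
    filter_upwards [hdom] with e he
    exact S.contDiffAt_chartBilin he
  have h₀ := S.chart_mem_chartDomain y₀
  obtain ⟨s, hs, hs'⟩ := exists_smooth_orthogonal_frame hL hB (S.injective_fderiv_chartIncl h₀)
    (S.chartBilin_nondegenerate h₀)
  obtain ⟨r, hr, hr'⟩ := exists_smooth_leftInverse hL (S.injective_fderiv_chartIncl h₀)
  -- `s e γ` is orthogonal to `TY`, hence tangent to `Y` by coisotropy. The left inverse `r e` of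
  -- the differential of the inclusion turns it into a vector of the parameter space.
  refine ⟨fun e => (r e).comp (s e), ?_, ?_⟩
  · filter_upwards [hs, hr] with e h1 h2
    exact h2.clm_comp h1
  · filter_upwards [hs', hr', hdom] with e h1 h2 he
    refine ⟨fun γ => ?_, fun a ha => ?_⟩
    · obtain ⟨a, ha⟩ := S.exists_fderiv_eq_of_orthogonal he _ (h1.1 γ)
      rw [ContinuousLinearMap.comp_apply, ← ha, h2, S.mem_nullSpace_chart he, ha]
      exact h1.1 γ
    · rw [ContinuousLinearMap.comp_apply, h1.2 _ ((S.mem_nullSpace_chart he a).1 ha), h2]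

/-- Choose `γ` whose frame vector at the centre is `v`. Keeping `γ` constant gives a local section
`c e γ`, and a bump function globalizes it. Conditions tested on leafwise fields can therefore be
applied to single null vectors. -/
theorem exists_leafwiseVectorField_eq [T2Space Y] (S : CoisotropicSubmanifold Ω F Y) (y : Y)
    (v : S.nullDistribution y) : ∃ σ : S.LeafwiseVectorField, σ.field y = v.1 := by
  obtain ⟨c, hc, hc'⟩ := S.exists_chart_frame y
  have hy := extChartAt_to_inv (I := 𝓘(ℝ, F)) y
  obtain ⟨a, ha⟩ := modelDeriv_chart_symm_surjective (F := F) (mem_extChartAt_target y) v.1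
  have hmem : modelDeriv F F (extChartAt 𝓘(ℝ, F) y).symm (extChartAt 𝓘(ℝ, F) y y) a ∈
      S.nullSpace ((extChartAt 𝓘(ℝ, F) y).symm (extChartAt 𝓘(ℝ, F) y y)) := by
    rw [hy, ha]
    exact v.2
  obtain ⟨γ, hγ⟩ : ∃ γ, c (extChartAt 𝓘(ℝ, F) y y) γ = a := ⟨_, hc'.self_of_nhds.2 a hmem⟩
  obtain ⟨σ, hσ⟩ := exists_leafwiseVectorField_eventuallyEq (S := S) y (s := fun e => c e γ)
    (hc.mono fun e he => he.clm_apply contDiffAt_const) (hc'.mono fun e he => he.1 γ)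
  refine ⟨σ, hσ.self_of_nhds.trans ?_⟩
  rw [hγ, ha]

/-- Every leafwise `1`-form is locally the normal part of a smooth vector field along `Y`. -/
theorem exists_local_normal_field [T2Space Y] (S : CoisotropicSubmanifold Ω F Y)
    (ξ : S.LeafwiseOneForm) (y₀ : Y) :
    ∃ V : Y → E, ContMDiff 𝓘(ℝ, F) 𝓘(ℝ, E) ∞ V ∧
      ∀ᶠ y in 𝓝 y₀, S.incl y ∈ (extChartAt 𝓘(ℝ, E) (S.incl y₀)).source ∧
        ∀ w : S.nullDistribution y, Ω.bilin (S.incl y)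
          (modelDeriv E E (extChartAt 𝓘(ℝ, E) (S.incl y₀)).symm
            (extChartAt 𝓘(ℝ, E) (S.incl y₀) (S.incl y)) (V y))
          (modelDeriv F E S.incl y w.1) = ξ.1 y w := by
  obtain ⟨c, hc, hc'⟩ := S.exists_chart_frame y₀
  have hσ : ∀ γ : E →L[ℝ] ℝ, ∃ σ : S.LeafwiseVectorField, ∀ᶠ y in 𝓝 y₀, σ.field y =
      modelDeriv F F (extChartAt 𝓘(ℝ, F) y₀).symm (extChartAt 𝓘(ℝ, F) y₀ y)
        (c (extChartAt 𝓘(ℝ, F) y₀ y) γ) := fun γ =>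
    exists_leafwiseVectorField_eventuallyEq (S := S) y₀ (s := fun e => c e γ)
      (hc.mono fun e he => he.clm_apply contDiffAt_const) (hc'.mono fun e he => he.1 γ)
  choose σ hσ using hσ
  let b := Module.finBasis ℝ E
  -- Write `σ_j` for the leafwise field of the dual basis functional `δ j`. With `β = ω(w, ·)`, a
  -- null vector is recovered as `w = Σ β(b_j) σ_j`.
  let δ : Fin (Module.finrank ℝ E) → E →L[ℝ] ℝ := fun j => LinearMap.toContinuousLinearMap (b.coord j)
  have hexp : ∀ β : E →L[ℝ] ℝ, β = ∑ j, β (b j) • δ j := by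
    intro β
    refine ContinuousLinearMap.coe_injective (b.ext fun i => ?_)
    simp [δ, Finsupp.single_apply]
  -- The sign compensates for `ω(V, w) = -β(V)`. With it, `ω(V, w) = Σ ξ(σ_j) β(b_j) = ξ(w)`.
  -- Smoothness of `V` is the smoothness of `ξ` tested on the fields `σ_j`.
  refine ⟨fun y => -∑ j, eval ξ (σ (δ j)) y • b j, ?_, ?_⟩
  · refine ContMDiff.neg ?_
    refine contMDiff_finsetSum fun j _ => ?_
    exact (ξ.2 (σ (δ j))).smul contMDiff_const
  have hcont : Tendsto (extChartAt 𝓘(ℝ, F) y₀) (𝓝 y₀) (𝓝 (extChartAt 𝓘(ℝ, F) y₀ y₀)) :=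
    continuousAt_extChartAt y₀
  filter_upwards [hcont.eventually hc', hcont.eventually (S.chartDomain_mem_nhds y₀),
    extChartAt_source_mem_nhds (I := 𝓘(ℝ, F)) y₀, eventually_all.2 fun j => hσ (δ j)]
    with y hcy hdom hsrc hσy
  have hinv := (extChartAt 𝓘(ℝ, F) y₀).left_inv hsrc
  have hmem := hdom.2
  rw [mem_ofPred_eq, hinv] at hmem
  refine ⟨hmem, fun w => ?_⟩
  obtain ⟨a, ha⟩ := modelDeriv_chart_symm_surjective (F := F) hdom.1 w.1
  have hwn : modelDeriv F F (extChartAt 𝓘(ℝ, F) y₀).symm (extChartAt 𝓘(ℝ, F) y₀ y) a ∈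
      S.nullSpace ((extChartAt 𝓘(ℝ, F) y₀).symm (extChartAt 𝓘(ℝ, F) y₀ y)) := by
    rw [hinv, ha]
    exact w.2
  set e := extChartAt 𝓘(ℝ, F) y₀ y with he
  have h1 := hcy.2 a hwn
  have h2 := S.chartBilin_fderiv hdom (-∑ j, eval ξ (σ (δ j)) y • b j) a
  have h3 : S.chartIncl y₀ e = extChartAt 𝓘(ℝ, E) (S.incl y₀) (S.incl y) := by
    rw [chartIncl, hinv]
  rw [h3, hinv, ha] at h2
  refine h2.symm.trans ?_
  set β := S.chartBilin y₀ e (fderiv ℝ (S.chartIncl y₀) e a) with hβ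
  have h4 : ∀ u, S.chartBilin y₀ e u (fderiv ℝ (S.chartIncl y₀) e a) = -β u := fun u =>
    twoFormBilin_swap _ _ _
  have h5 : (w.1 : F) = ∑ j, β (b j) • ((σ (δ j)).field y : F) := by
    rw [← ha, ← h1]
    conv_lhs => rw [hexp β]
    simp only [map_sum, map_smul]
    refine Finset.sum_congr rfl fun j _ => ?_
    exact congrArg (β (b j) • ·) (hσy j).symm
  have h6 : w = ∑ j, β (b j) • (⟨(σ (δ j)).field y, (σ (δ j)).mem y⟩ : S.nullDistribution y) := by
    refine Subtype.ext (h5.trans ?_)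
    rw [Submodule.coe_sum]
    rfl
  rw [h4, h6, map_neg, neg_neg, map_sum, map_sum]
  refine Finset.sum_congr rfl fun j _ => ?_
  rw [map_smul, map_smul, smul_eq_mul, smul_eq_mul, mul_comm]
  rfl

/-- The leafwise differential squares to zero. -/
theorem d₁_d₀ (S : CoisotropicSubmanifold Ω F Y) (f : C^∞⟮𝓘(ℝ, F), Y; 𝓘(ℝ, ℝ), ℝ⟯) :
    S.d₁ (S.d₀ f) = 0 := by
  funext σ τ y
  have htgt := mem_extChartAt_target (I := 𝓘(ℝ, F)) y
  obtain ⟨a, ha⟩ := modelDeriv_chart_symm_surjective htgt (σ.field y : F)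
  obtain ⟨b, hb⟩ := modelDeriv_chart_symm_surjective htgt (τ.field y : F)
  set k : F → ℝ := fun e => f ((extChartAt 𝓘(ℝ, F) y).symm e) with hk
  have hks : ContDiffAt ℝ ∞ k (extChartAt 𝓘(ℝ, F) y y) :=
    (f.contMDiff.contMDiffAt.comp _ (contMDiffAt_chart_symm htgt)).contDiffAt
  -- The form `d_𝓕 f` is represented by the full differential of the chart expression of `f`, so the
  -- claim is symmetry of second derivatives.
  rw [d₁_eq_of_chart (S.d₀ f) σ τ y (α := fderiv ℝ k) ?_ ?_ ha hb]
  · have hsymm : IsSymmSndFDerivAt ℝ k (extChartAt 𝓘(ℝ, F) y y) :=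
      hks.isSymmSndFDerivAt (by simp; exact ENat.LEInfty.out)
    rw [hsymm.eq a b, sub_self]
    rfl
  · exact (hks.fderiv_right (m := ∞) (by simp)).differentiableAt (by simp)
  · filter_upwards [(isOpen_extChartAt_target (I := 𝓘(ℝ, F)) y).mem_nhds htgt] with e he w a hw
    have h1 := modelDeriv_comp (E := ℝ) e (f.contMDiff.mdifferentiable (by simp) _)
      (mdifferentiableAt_chart_symm he)
    rw [modelDeriv_eq_fderiv] at h1
    refine Eq.trans ?_ (congrArg (fun T : F →L[ℝ] ℝ => T a) h1).symm
    change modelDeriv F ℝ f _ w.1 = modelDeriv F ℝ f _ (modelDeriv F F _ e a)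
    rw [hw]

end CoisotropicSubmanifold

/-! ### Curves in the tangent bundle -/

section TangentCurves

variable {E : Type*} [NormedAddCommGroup E] [NormedSpace ℝ E]
  {X : Type*} [TopologicalSpace X] [ChartedSpace E X] [IsManifold 𝓘(ℝ, E) ∞ X]

/-- The tangent map of the chart sends the curve into the trivial bundle `TE`, where the fibre
component is differentiable. The next lemma goes back with the inverse chart; together they exchange
curves in `TX` for curves in `E`. -/
theorem differentiableAt_chart_of_tangentCurve {x₀ : X} {c : ℝ → X} {t₀ : ℝ}
    {u : ∀ t, TangentSpace 𝓘(ℝ, E) (c t)}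
    (hu : MDifferentiableAt 𝓘(ℝ, ℝ) 𝓘(ℝ, E).tangent
      (fun t => (⟨c t, u t⟩ : TangentBundle 𝓘(ℝ, E) X)) t₀)
    (hc : c t₀ ∈ (extChartAt 𝓘(ℝ, E) x₀).source) :
    DifferentiableAt ℝ (fun t => modelDeriv E E (extChartAt 𝓘(ℝ, E) x₀) (c t) (u t)) t₀ := by
  have hU := isOpen_extChartAt_source (I := 𝓘(ℝ, E)) x₀
  have h2 : ContMDiffOn 𝓘(ℝ, E) 𝓘(ℝ, E) ∞ (extChartAt 𝓘(ℝ, E) x₀)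
      (extChartAt 𝓘(ℝ, E) x₀).source :=
    fun y hy => (contMDiffAt_extChartAt' (by simpa using hy)).contMDiffWithinAt
  have hopen : IsOpen {p : TangentBundle 𝓘(ℝ, E) X | p.proj ∈ (extChartAt 𝓘(ℝ, E) x₀).source} :=
    hU.preimage (FiberBundle.continuous_proj E (TangentSpace 𝓘(ℝ, E)))
  have h3 := ((contMDiffOn_tangentMap hU h2).contMDiffAt
    (x := (⟨c t₀, u t₀⟩ : TangentBundle 𝓘(ℝ, E) X))
    (hopen.mem_nhds hc)).mdifferentiableAt (by simp)
  have h4 := ((contMDiff_snd_tangentBundle_modelSpace E 𝓘(ℝ, E)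
    (n := ∞)).mdifferentiable (by simp)).mdifferentiableAt.comp t₀ (h3.comp t₀ hu)
  exact h4.differentiableAt

theorem mdifferentiableAt_tangentCurve {x₀ : X} {c u : ℝ → E} {t₀ : ℝ}
    (hc : DifferentiableAt ℝ c t₀) (hu : DifferentiableAt ℝ u t₀)
    (ht : c t₀ ∈ (extChartAt 𝓘(ℝ, E) x₀).target) :
    MDifferentiableAt 𝓘(ℝ, ℝ) 𝓘(ℝ, E).tangent
      (fun t => (⟨(extChartAt 𝓘(ℝ, E) x₀).symm (c t),
        modelDeriv E E (extChartAt 𝓘(ℝ, E) x₀).symm (c t) (u t)⟩ : TangentBundle 𝓘(ℝ, E) X)) t₀ := by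
  have hU := isOpen_extChartAt_target (I := 𝓘(ℝ, E)) x₀
  have h1 : MDifferentiableAt 𝓘(ℝ, ℝ) 𝓘(ℝ, E).tangent
      (fun t => (⟨c t, u t⟩ : TangentBundle 𝓘(ℝ, E) E)) t₀ := by
    refine (mdifferentiableAt_totalSpace _ _).2 ⟨hc.mdifferentiableAt, ?_⟩
    convert! hu.mdifferentiableAt with t
    simp
  have hopen : IsOpen {p : TangentBundle 𝓘(ℝ, E) E | p.proj ∈ (extChartAt 𝓘(ℝ, E) x₀).target} :=
    hU.preimage (FiberBundle.continuous_proj E (TangentSpace 𝓘(ℝ, E)))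
  have h3 := ((contMDiffOn_tangentMap hU (contMDiffOn_extChartAt_symm (n := ∞) x₀)).contMDiffAt
    (x := (⟨c t₀, u t₀⟩ : TangentBundle 𝓘(ℝ, E) E))
    (hopen.mem_nhds ht)).mdifferentiableAt (by simp)
  exact h3.comp t₀ h1

end TangentCurves

namespace SymplecticForm

theorem mem_orthogonal_range {E : Type*} [NormedAddCommGroup E] [NormedSpace ℝ E]
    {X : Type*} [TopologicalSpace X] [ChartedSpace E X] (Ω : SymplecticForm E X)
    {F : Type*} [NormedAddCommGroup F] [NormedSpace ℝ F]
    {Y : Type*} [TopologicalSpace Y] [ChartedSpace F Y] (f : Y → X) (y : Y)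
    (u : TangentSpace 𝓘(ℝ, E) (f y)) :
    u ∈ Ω.orthogonal (LinearMap.range (mfderiv 𝓘(ℝ, F) 𝓘(ℝ, E) f y).toLinearMap) ↔
      ∀ w : F, Ω.bilin (f y) u (modelDeriv F E f y w) = 0 := by
  constructor
  · intro h w
    exact (Ω.bilin_apply _ _ _).trans (h _ ⟨w, rfl⟩)
  · rintro h _ ⟨w, rfl⟩
    exact (Ω.bilin_apply _ _ _).symm.trans (h w)

end SymplecticForm

/-! ### Deformations in charts -/

namespace CoisotropicSubmanifold

variable {E : Type*} [NormedAddCommGroup E] [NormedSpace ℝ E]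
  {X : Type*} [TopologicalSpace X] [ChartedSpace E X] {Ω : SymplecticForm E X}
  {F : Type*} [NormedAddCommGroup F] [NormedSpace ℝ F]
  {Y : Type*} [TopologicalSpace Y] [ChartedSpace F Y]
  [IsManifold 𝓘(ℝ, F) ∞ Y] [IsManifold 𝓘(ℝ, E) ∞ X]

/-- A family of maps `Y → X` in the chart around `y₀` and the chart around `x₀`. -/
noncomputable def chartFamily (φ : ℝ → Y → X) (x₀ : X) (y₀ : Y) (p : ℝ × F) : E :=
  extChartAt 𝓘(ℝ, E) x₀ (φ p.1 ((extChartAt 𝓘(ℝ, F) y₀).symm p.2))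

/-- The points at which a family of maps is represented by `chartFamily` and smooth. -/
def IsChartPoint (φ : ℝ → Y → X) (x₀ : X) (y₀ : Y) (p : ℝ × F) : Prop :=
  p.2 ∈ (extChartAt 𝓘(ℝ, F) y₀).target ∧
    φ p.1 ((extChartAt 𝓘(ℝ, F) y₀).symm p.2) ∈ (extChartAt 𝓘(ℝ, E) x₀).source ∧
    ContMDiffAt (𝓘(ℝ, ℝ).prod 𝓘(ℝ, F)) 𝓘(ℝ, E) ∞ (fun p : ℝ × Y => φ p.1 p.2)
      (p.1, (extChartAt 𝓘(ℝ, F) y₀).symm p.2)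

variable {φ : ℝ → Y → X} {x₀ : X} {y₀ : Y} {p : ℝ × F}

theorem IsChartPoint.contMDiffAt (h : IsChartPoint (E := E) φ x₀ y₀ p) :
    ContMDiffAt 𝓘(ℝ, ℝ × F) 𝓘(ℝ, E) ∞
      (fun q : ℝ × F => φ q.1 ((extChartAt 𝓘(ℝ, F) y₀).symm q.2)) p := by
  have h1 : ContMDiffAt 𝓘(ℝ, ℝ × F) 𝓘(ℝ, ℝ) ∞ (fun q : ℝ × F => q.1) p :=
    contDiffAt_fst.contMDiffAt
  have h2 : ContMDiffAt 𝓘(ℝ, ℝ × F) 𝓘(ℝ, F) ∞ (fun q : ℝ × F => q.2) p :=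
    contDiffAt_snd.contMDiffAt
  exact ContMDiffAt.comp p h.2.2 (h1.prodMk ((contMDiffAt_chart_symm h.1).comp p h2))

theorem IsChartPoint.contDiffAt (h : IsChartPoint (E := E) φ x₀ y₀ p) :
    ContDiffAt ℝ ∞ (chartFamily (E := E) φ x₀ y₀) p := by
  have h2 : ContMDiffAt 𝓘(ℝ, E) 𝓘(ℝ, E) ∞ (extChartAt 𝓘(ℝ, E) x₀)
      (φ p.1 ((extChartAt 𝓘(ℝ, F) y₀).symm p.2)) :=
    contMDiffAt_extChartAt' (by simpa using h.2.1)
  exact (h2.comp p h.contMDiffAt).contDiffAt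

theorem IsChartPoint.mdifferentiableAt_space (h : IsChartPoint (E := E) φ x₀ y₀ p) :
    MDifferentiableAt 𝓘(ℝ, F) 𝓘(ℝ, E) (φ p.1) ((extChartAt 𝓘(ℝ, F) y₀).symm p.2) :=
  (ContMDiffAt.comp ((extChartAt 𝓘(ℝ, F) y₀).symm p.2) (f := fun z : Y => (p.1, z)) h.2.2
    (contMDiffAt_const.prodMk contMDiffAt_id)).mdifferentiableAt (by simp)

theorem IsChartPoint.mdifferentiableAt_time (h : IsChartPoint (E := E) φ x₀ y₀ p) :
    MDifferentiableAt 𝓘(ℝ, ℝ) 𝓘(ℝ, E) (fun t => φ t ((extChartAt 𝓘(ℝ, F) y₀).symm p.2)) p.1 :=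
  (ContMDiffAt.comp p.1 (f := fun t : ℝ => (t, (extChartAt 𝓘(ℝ, F) y₀).symm p.2)) h.2.2
    (contMDiffAt_id.prodMk contMDiffAt_const)).mdifferentiableAt (by simp)

theorem IsChartPoint.chartFamily_mem_target (h : IsChartPoint (E := E) φ x₀ y₀ p) :
    chartFamily φ x₀ y₀ p ∈ (extChartAt 𝓘(ℝ, E) x₀).target :=
  (extChartAt 𝓘(ℝ, E) x₀).map_source h.2.1

theorem IsChartPoint.chart_symm_chartFamily (h : IsChartPoint (E := E) φ x₀ y₀ p) :
    (extChartAt 𝓘(ℝ, E) x₀).symm (chartFamily φ x₀ y₀ p) =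
      φ p.1 ((extChartAt 𝓘(ℝ, F) y₀).symm p.2) :=
  (extChartAt 𝓘(ℝ, E) x₀).left_inv h.2.1

theorem IsChartPoint.chart_symm_fderiv_space (h : IsChartPoint (E := E) φ x₀ y₀ p) (a : F) :
    modelDeriv E E (extChartAt 𝓘(ℝ, E) x₀).symm (chartFamily φ x₀ y₀ p)
        (fderiv ℝ (chartFamily φ x₀ y₀) p (0, a)) =
      modelDeriv F E (φ p.1) ((extChartAt 𝓘(ℝ, F) y₀).symm p.2)
        (modelDeriv F F (extChartAt 𝓘(ℝ, F) y₀).symm p.2 a) := by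
  have h1 := mdifferentiableAt_chart_symm h.1
  have h2 := h.mdifferentiableAt_space
  have h3 := modelDeriv_chart_symm_comp (h2.comp p.2 h1) h.2.1 a
  have h4 := modelDeriv_comp (E := E) p.2 h2 h1
  have h5 : HasFDerivAt (fun e : F => chartFamily (E := E) φ x₀ y₀ (p.1, e))
      ((fderiv ℝ (chartFamily (E := E) φ x₀ y₀) p).comp (ContinuousLinearMap.inr ℝ ℝ F)) p.2 :=
    HasFDerivAt.comp (g := chartFamily (E := E) φ x₀ y₀) p.2
      (h.contDiffAt.differentiableAt (by simp)).hasFDerivAt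
      (hasFDerivAt_prodMk_right (𝕜 := ℝ) p.1 p.2)
  have h6 : modelDeriv F E (fun e : F => chartFamily (E := E) φ x₀ y₀ (p.1, e)) p.2 a =
      fderiv ℝ (chartFamily (E := E) φ x₀ y₀) p (0, a) := by
    rw [modelDeriv_eq_fderiv, h5.fderiv]
    rfl
  rw [← h6]
  exact h3.trans (congrArg (fun T : F →L[ℝ] E => T a) h4)

theorem IsChartPoint.chart_symm_fderiv_time (h : IsChartPoint (E := E) φ x₀ y₀ p) :
    modelDeriv E E (extChartAt 𝓘(ℝ, E) x₀).symm (chartFamily φ x₀ y₀ p)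
        (fderiv ℝ (chartFamily φ x₀ y₀) p (1, 0)) =
      modelDeriv ℝ E (fun t => φ t ((extChartAt 𝓘(ℝ, F) y₀).symm p.2)) p.1 1 := by
  have h2 := h.mdifferentiableAt_time
  have h3 := modelDeriv_chart_symm_comp h2 h.2.1 1
  have h5 : HasFDerivAt (fun t : ℝ => chartFamily (E := E) φ x₀ y₀ (t, p.2))
      ((fderiv ℝ (chartFamily (E := E) φ x₀ y₀) p).comp (ContinuousLinearMap.inl ℝ ℝ F)) p.1 :=
    HasFDerivAt.comp (g := chartFamily (E := E) φ x₀ y₀) p.1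
      (h.contDiffAt.differentiableAt (by simp)).hasFDerivAt
      (hasFDerivAt_prodMk_left (𝕜 := ℝ) p.1 p.2)
  have h6 : modelDeriv ℝ E (fun t : ℝ => chartFamily (E := E) φ x₀ y₀ (t, p.2)) p.1 1 =
      fderiv ℝ (chartFamily (E := E) φ x₀ y₀) p (1, 0) := by
    rw [modelDeriv_eq_fderiv, h5.fderiv]
    rfl
  rw [← h6]
  exact h3

variable {S : CoisotropicSubmanifold Ω F Y}

/-- Openness of the domain of smoothness makes all chart computations valid near `(0, y)`, even
though no uniform time interval over `Y` is available. -/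
theorem IsDeformation.eventually_isChartPoint (hφ : S.IsDeformation φ) (y : Y) :
    ∀ᶠ p in 𝓝 ((0 : ℝ), extChartAt 𝓘(ℝ, F) y y), IsChartPoint (E := E) φ (S.incl y) y p := by
  obtain ⟨W, hW, hW0, hsm⟩ := hφ.smooth
  have hy := extChartAt_to_inv (I := 𝓘(ℝ, F)) y
  have hc : ContinuousAt (fun p : ℝ × F => (p.1, (extChartAt 𝓘(ℝ, F) y).symm p.2))
      ((0 : ℝ), extChartAt 𝓘(ℝ, F) y y) :=
    continuousAt_fst.prodMk
      (ContinuousAt.comp (g := (extChartAt 𝓘(ℝ, F) y).symm) (f := Prod.snd)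
        (x := ((0 : ℝ), extChartAt 𝓘(ℝ, F) y y)) (continuousAt_extChartAt_symm y) continuousAt_snd)
  have hWn : W ∈ 𝓝 ((0 : ℝ), y) := hW.mem_nhds (hW0 y)
  have h1 : ∀ᶠ p in 𝓝 ((0 : ℝ), extChartAt 𝓘(ℝ, F) y y),
      (p.1, (extChartAt 𝓘(ℝ, F) y).symm p.2) ∈ W := by
    refine hc.eventually_mem ?_
    simpa only [hy] using hWn
  have h2 : ContinuousAt (fun p : ℝ × Y => φ p.1 p.2) ((0 : ℝ), y) :=
    (hsm.contMDiffAt hWn).continuousAt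
  have h3 : ∀ᶠ p in 𝓝 ((0 : ℝ), extChartAt 𝓘(ℝ, F) y y),
      φ p.1 ((extChartAt 𝓘(ℝ, F) y).symm p.2) ∈ (extChartAt 𝓘(ℝ, E) (S.incl y)).source := by
    have h4 : ∀ᶠ q in 𝓝 ((0 : ℝ), y), φ q.1 q.2 ∈ (extChartAt 𝓘(ℝ, E) (S.incl y)).source := by
      refine h2.eventually_mem ?_
      rw [hφ.zero]
      exact extChartAt_source_mem_nhds _
    have h5 : Tendsto (fun p : ℝ × F => (p.1, (extChartAt 𝓘(ℝ, F) y).symm p.2))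
        (𝓝 ((0 : ℝ), extChartAt 𝓘(ℝ, F) y y)) (𝓝 ((0 : ℝ), y)) := by
      have := hc.tendsto
      simpa only [hy] using this
    exact h5.eventually h4
  have h6 : ∀ᶠ p in 𝓝 ((0 : ℝ), extChartAt 𝓘(ℝ, F) y y), p.2 ∈ (extChartAt 𝓘(ℝ, F) y).target :=
    continuousAt_snd.eventually_mem (extChartAt_target_mem_nhds (I := 𝓘(ℝ, F)) y)
  filter_upwards [h1, h3, h6] with p hp1 hp3 hp6
  exact ⟨hp6, hp3, hsm.contMDiffAt (hW.mem_nhds hp1)⟩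

variable [FiniteDimensional ℝ F]

/-- The normal velocity of a deformation is represented in a chart by the velocity form. -/
theorem HasNormalVelocity.eq_velocityForm {ξ : S.LeafwiseOneForm}
    (hξ : S.HasNormalVelocity φ ξ) {y : Y} {x₀ : X} {e : F} (he : IsChartPoint (E := E) φ x₀ y (0, e))
    (w : S.nullDistribution ((extChartAt 𝓘(ℝ, F) y).symm e)) (a : F)
    (ha : modelDeriv F F (extChartAt 𝓘(ℝ, F) y).symm e a = w.1) :
    ξ.1 _ w = velocityForm (twoFormInChart Ω.form x₀) (chartFamily φ x₀ y) e a := by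
  rw [velocityForm_apply, SymplecticForm.twoFormBilin_inChart, he.chart_symm_fderiv_space,
    he.chart_symm_fderiv_time, he.chart_symm_chartFamily, ha, SymplecticForm.bilin_apply]
  exact (hξ _ w).symm

end CoisotropicSubmanifold

/-! ### Coisotropy to first order -/

namespace CoisotropicSubmanifold

variable {E : Type*} [NormedAddCommGroup E] [NormedSpace ℝ E]
  {X : Type*} [TopologicalSpace X] [ChartedSpace E X] {Ω : SymplecticForm E X}
  {F : Type*} [NormedAddCommGroup F] [NormedSpace ℝ F] [FiniteDimensional ℝ F]
  {Y : Type*} [TopologicalSpace Y] [ChartedSpace F Y]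
  [IsManifold 𝓘(ℝ, F) ∞ Y] [IsManifold 𝓘(ℝ, E) ∞ X]
  {S : CoisotropicSubmanifold Ω F Y} {φ : ℝ → Y → X} {ξ : S.LeafwiseOneForm}

/-- The first variation of the symplectic form on the orthogonals of the tangent spaces of a
deformation is minus the leafwise differential of its normal velocity. -/
theorem IsDeformation.hasDerivAt_form (hφ : S.IsDeformation φ) (hξ : S.HasNormalVelocity φ ξ)
    (σ τ : S.LeafwiseVectorField) (y : Y) {u v : ∀ t : ℝ, TangentSpace 𝓘(ℝ, E) (φ t y)}
    (hu : MDifferentiableAt 𝓘(ℝ, ℝ) 𝓘(ℝ, E).tangent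
      (fun t => (⟨φ t y, u t⟩ : TangentBundle 𝓘(ℝ, E) X)) 0)
    (hv : MDifferentiableAt 𝓘(ℝ, ℝ) 𝓘(ℝ, E).tangent
      (fun t => (⟨φ t y, v t⟩ : TangentBundle 𝓘(ℝ, E) X)) 0)
    (hu₀ : u 0 = modelDeriv F E S.incl y (σ.field y))
    (hv₀ : v 0 = modelDeriv F E S.incl y (τ.field y))
    (huv : ∀ᶠ t in 𝓝 (0 : ℝ), (∀ w, Ω.bilin (φ t y) (u t) (modelDeriv F E (φ t) y w) = 0) ∧
      ∀ w, Ω.bilin (φ t y) (v t) (modelDeriv F E (φ t) y w) = 0) :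
    HasDerivAt (fun t => Ω.form (φ t y) ![u t, v t]) (-S.d₁ ξ σ τ y) 0 := by
  set e₀ := extChartAt 𝓘(ℝ, F) y y with he₀
  set x₀ := S.incl y with hx₀
  set G : ℝ × F → E := chartFamily φ x₀ y with hG
  have hy : (extChartAt 𝓘(ℝ, F) y).symm e₀ = y := extChartAt_to_inv y
  have hpt := hφ.eventually_isChartPoint y
  have hpt₀ : IsChartPoint (E := E) φ x₀ y (0, e₀) := hpt.self_of_nhds
  have hptt : ∀ᶠ t in 𝓝 (0 : ℝ), IsChartPoint (E := E) φ x₀ y (t, e₀) :=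
    (Continuous.prodMk_left e₀).continuousAt.eventually hpt
  have hpte : ∀ᶠ e in 𝓝 e₀, IsChartPoint (E := E) φ x₀ y (0, e) :=
    (Continuous.prodMk_right (0 : ℝ)).continuousAt.eventually hpt
  have hGt : ∀ t, G (t, e₀) = extChartAt 𝓘(ℝ, E) x₀ (φ t y) := by
    intro t
    rw [hG, chartFamily, hy]
  obtain ⟨a, ha⟩ := modelDeriv_chart_symm_surjective (F := F) hpt₀.1 (σ.field y)
  obtain ⟨b, hb⟩ := modelDeriv_chart_symm_surjective (F := F) hpt₀.1 (τ.field y)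
  have hsrc : ∀ {t}, IsChartPoint (E := E) φ x₀ y (t, e₀) →
      φ t y ∈ (extChartAt 𝓘(ℝ, E) x₀).source := by
    intro t ht
    have := ht.2.1
    rwa [hy] at this
  -- This supplies the initial condition of the first variation formula: at time zero the chart
  -- images of `u` and `v` are spatial derivatives of `G`.
  have hG₀ : ∀ {c : F} {w : F}, modelDeriv F F (extChartAt 𝓘(ℝ, F) y).symm e₀ c = w →
      modelDeriv E E (extChartAt 𝓘(ℝ, E) x₀) (φ 0 y) (modelDeriv F E S.incl y w) =
        fderiv ℝ G (0, e₀) (0, c) := by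
    intro c w hc
    have h1 := hpt₀.chart_symm_fderiv_space c
    have h2 := modelDeriv_chart_chart_symm hpt₀.chartFamily_mem_target (fderiv ℝ G (0, e₀) (0, c))
    rw [h1, hpt₀.chart_symm_chartFamily] at h2
    simp only [hy, hc] at h2
    rw [hφ.zero] at h2 ⊢
    exact h2
  have hα := differentiableAt_velocityForm hpt₀.contDiffAt
    ((Ω.contDiffAt_inChart hpt₀.chartFamily_mem_target).differentiableAt (by simp))
  -- By definition of the normal velocity, the velocity form represents `ξ` on null vectors.
  have hd₁ := d₁_eq_of_chart ξ σ τ y hα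
    (hpte.mono fun e he w a haw => hξ.eq_velocityForm he w a haw) ha hb
  rw [hd₁]
  -- Orthogonality to the image of `dφ_t` is transported to the chart at each small time.
  have horth : ∀ {t : ℝ} {w : E}, IsChartPoint (E := E) φ x₀ y (t, e₀) →
      (∀ c, Ω.bilin (φ t y) w (modelDeriv F E (φ t) y c) = 0) → ∀ c,
      twoFormBilin E (twoFormInChart Ω.form x₀ (G (t, e₀)))
        (modelDeriv E E (extChartAt 𝓘(ℝ, E) x₀) (φ t y) w) (fderiv ℝ G (t, e₀) (0, c)) = 0 := by
    intro t w ht hw c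
    rw [SymplecticForm.twoFormBilin_inChart, ht.chart_symm_fderiv_space,
      ht.chart_symm_chartFamily, hGt, modelDeriv_chart_symm_chart (hsrc ht)]
    simp only [hy]
    exact hw _
  have hmain := hasDerivAt_twoForm_of_orthogonal (β := twoFormInChart Ω.form x₀) (G := G)
    (e₀ := e₀) (a := a) (b := b) hpt₀.contDiffAt
    ((Ω.contDiffAt_inChart hpt₀.chartFamily_mem_target).differentiableAt (by simp))
    (Ω.closed _ _ hpt₀.chartFamily_mem_target)
    (differentiableAt_chart_of_tangentCurve hu (hsrc hpt₀))
    (differentiableAt_chart_of_tangentCurve hv (hsrc hpt₀))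
    ((congrArg _ hu₀).trans (hG₀ ha)) ((congrArg _ hv₀).trans (hG₀ hb))
    ((hptt.and huv).mono fun t ht => horth ht.1 ht.2.1)
    ((hptt.and huv).mono fun t ht => horth ht.1 ht.2.2)
  refine hmain.congr_of_eventuallyEq ?_
  filter_upwards [hptt] with t ht
  rw [hGt]
  exact (Ω.bilin_apply _ _ _).symm.trans (Ω.twoFormBilin_inChart_chart (hsrc ht) _ _).symm

/-- Vectors of `T𝓕` extend to smooth curves of vectors orthogonal to a deformation. -/
theorem IsDeformation.exists_orthogonal_curve [FiniteDimensional ℝ E] (hφ : S.IsDeformation φ)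
    (y : Y) (w : S.nullDistribution y) :
    ∃ u : ∀ t : ℝ, TangentSpace 𝓘(ℝ, E) (φ t y),
      MDifferentiableAt 𝓘(ℝ, ℝ) 𝓘(ℝ, E).tangent
        (fun t => (⟨φ t y, u t⟩ : TangentBundle 𝓘(ℝ, E) X)) 0 ∧
      u 0 = modelDeriv F E S.incl y w.1 ∧
      ∀ᶠ t in 𝓝 (0 : ℝ), ∀ c, Ω.bilin (φ t y) (u t) (modelDeriv F E (φ t) y c) = 0 := by
  set e₀ := extChartAt 𝓘(ℝ, F) y y with he₀
  set x₀ := S.incl y with hx₀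
  set G : ℝ × F → E := chartFamily φ x₀ y with hG
  have hy : (extChartAt 𝓘(ℝ, F) y).symm e₀ = y := extChartAt_to_inv y
  have hpt := hφ.eventually_isChartPoint y
  have hpt₀ : IsChartPoint (E := E) φ x₀ y (0, e₀) := hpt.self_of_nhds
  have hptt : ∀ᶠ t in 𝓝 (0 : ℝ), IsChartPoint (E := E) φ x₀ y (t, e₀) :=
    (Continuous.prodMk_left e₀).continuousAt.eventually hpt
  have hGt : ∀ {t}, IsChartPoint (E := E) φ x₀ y (t, e₀) →
      (extChartAt 𝓘(ℝ, E) x₀).symm (G (t, e₀)) = φ t y := by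
    intro t ht
    rw [ht.chart_symm_chartFamily, hy]
  set L : ℝ → F →L[ℝ] E := fun t => (fderiv ℝ G (t, e₀)).comp (ContinuousLinearMap.inr ℝ ℝ F)
    with hLdef
  set B : ℝ → E →L[ℝ] E →L[ℝ] ℝ := fun t => twoFormBilin E (twoFormInChart Ω.form x₀ (G (t, e₀)))
    with hBdef
  have hline : ∀ t : ℝ, ContDiffAt ℝ ∞ (fun t : ℝ => (t, e₀)) t := fun t =>
    contDiffAt_id.prodMk contDiffAt_const
  have hL : ∀ᶠ t in 𝓝 (0 : ℝ), ContDiffAt ℝ ∞ L t := by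
    filter_upwards [hptt] with t ht
    have h1 : ContDiffAt ℝ ∞ (fderiv ℝ G) (t, e₀) :=
      ht.contDiffAt.fderiv_right (m := ∞) (by simp)
    exact (ContDiffAt.comp (g := fderiv ℝ G) t h1 (hline t)).clm_comp contDiffAt_const
  have hB : ∀ᶠ t in 𝓝 (0 : ℝ), ContDiffAt ℝ ∞ B t := by
    filter_upwards [hptt] with t ht
    have h1 : ContDiffAt ℝ ∞ (fun t : ℝ => G (t, e₀)) t :=
      ContDiffAt.comp (g := G) t ht.contDiffAt (hline t)
    exact contDiff_twoFormBilin.contDiffAt.comp t (ContDiffAt.comp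
      (g := twoFormInChart Ω.form x₀) t (Ω.contDiffAt_inChart ht.chartFamily_mem_target) h1)
  have hL₀ : ∀ c, modelDeriv E E (extChartAt 𝓘(ℝ, E) x₀).symm (G (0, e₀)) (L 0 c) =
      modelDeriv F E S.incl y (modelDeriv F F (extChartAt 𝓘(ℝ, F) y).symm e₀ c) := by
    intro c
    have h1 := hpt₀.chart_symm_fderiv_space c
    simp only [hy, hφ.zero] at h1
    exact h1
  have hinj : Function.Injective (L 0) := by
    refine (injective_iff_map_eq_zero _).2 fun c hc => ?_
    have h1 := hL₀ c
    rw [hc, map_zero] at h1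
    have h2 := (injective_iff_map_eq_zero _).1 (S.injective_modelDeriv_incl y) _ h1.symm
    have h3 := modelDeriv_chart_chart_symm hpt₀.1 c
    rw [h2, map_zero] at h3
    exact h3.symm
  obtain ⟨s, hs, hs'⟩ := exists_smooth_orthogonal_frame hL hB hinj
    (Ω.inChart_nondegenerate hpt₀.chartFamily_mem_target)
  obtain ⟨a, ha⟩ := modelDeriv_chart_symm_surjective (F := F) hpt₀.1 w.1
  -- Since `w` is null, `L 0 a` is orthogonal to the tangent space at time zero, so the frame
  -- recovers it from its functional `γ`. Holding `γ` fixed and letting the frame move gives the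
  -- required curve.
  have hB₀ : ∀ c, B 0 (L 0 a) (L 0 c) = 0 := by
    intro c
    rw [hBdef]
    change twoFormBilin E (twoFormInChart Ω.form x₀ (G (0, e₀))) (L 0 a) (L 0 c) = 0
    rw [SymplecticForm.twoFormBilin_inChart, hL₀, hL₀, ha, hGt hpt₀, hφ.zero]
    exact (S.mem_nullSpace y w.1).1 w.2 _
  set γ := B 0 (L 0 a) with hγ
  have hu₀ : s 0 γ = L 0 a := hs'.self_of_nhds.2 _ hB₀
  refine ⟨fun t => modelDeriv E E (extChartAt 𝓘(ℝ, E) x₀).symm (G (t, e₀)) (s t γ), ?_, ?_, ?_⟩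
  · have hc : DifferentiableAt ℝ (fun t => G (t, e₀)) 0 :=
      (ContDiffAt.comp (g := G) (0 : ℝ) hpt₀.contDiffAt (hline 0)).differentiableAt (by simp)
    have h1 := mdifferentiableAt_tangentCurve (X := X) (x₀ := x₀) hc
      ((hs.self_of_nhds.clm_apply (contDiffAt_const (c := γ))).differentiableAt (by simp))
      hpt₀.chartFamily_mem_target
    refine h1.congr_of_eventuallyEq ?_
    filter_upwards [hptt] with t ht
    exact (tangentBundle_mk_eq (hGt ht) _).symm
  · change modelDeriv E E (extChartAt 𝓘(ℝ, E) x₀).symm (G (0, e₀)) (s 0 γ) = _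
    rw [hu₀, hL₀, ha]
  · filter_upwards [hptt, hs'] with t ht hst c
    obtain ⟨c, rfl⟩ := modelDeriv_chart_symm_surjective (F := F) hpt₀.1 c
    have h1 := hst.1 γ c
    rw [hBdef] at h1
    change twoFormBilin E (twoFormInChart Ω.form x₀ (G (t, e₀))) (s t γ)
      (fderiv ℝ G (t, e₀) (0, c)) = 0 at h1
    rw [SymplecticForm.twoFormBilin_inChart, ht.chart_symm_fderiv_space, hGt ht] at h1
    simpa only [hy] using h1

/-- A deformation is coisotropic to first order iff its normal velocity is leafwise closed. -/
theorem IsDeformation.isCoisotropicToFirstOrder_iff [FiniteDimensional ℝ E] [T2Space Y]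
    (hφ : S.IsDeformation φ) (hξ : S.HasNormalVelocity φ ξ) :
    IsCoisotropicToFirstOrder (F := F) Ω φ ↔ S.d₁ ξ = 0 := by
  constructor
  · intro h
    funext σ τ y
    -- Along curves starting at `σ` and `τ` the derivative is `-(d_𝓕 ξ)(σ, τ)`, whereas first-order
    -- coisotropy makes it zero.
    obtain ⟨u, hu, hu₀, huo⟩ := hφ.exists_orthogonal_curve y ⟨σ.field y, σ.mem y⟩
    obtain ⟨v, hv, hv₀, hvo⟩ := hφ.exists_orthogonal_curve y ⟨τ.field y, τ.mem y⟩
    have h1 := hφ.hasDerivAt_form hξ σ τ y hu hv hu₀ hv₀ (huo.and hvo)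
    have h2 := h y u v hu hv ((huo.and hvo).mono fun t ht =>
      ⟨(Ω.mem_orthogonal_range (φ t) y (u t)).2 ht.1,
        (Ω.mem_orthogonal_range (φ t) y (v t)).2 ht.2⟩)
    exact neg_eq_zero.1 (h1.unique h2)
  · intro h y u v hu hv huv
    have huv' : ∀ᶠ t in 𝓝 (0 : ℝ),
        (∀ w, Ω.bilin (φ t y) (u t) (modelDeriv F E (φ t) y w) = 0) ∧
        ∀ w, Ω.bilin (φ t y) (v t) (modelDeriv F E (φ t) y w) = 0 :=
      huv.mono fun t ht => ⟨(Ω.mem_orthogonal_range (φ t) y (u t)).1 ht.1,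
        (Ω.mem_orthogonal_range (φ t) y (v t)).1 ht.2⟩
    -- An orthogonal vector at time zero is tangent by coisotropy, hence null. Thus any admissible
    -- pair of curves starts at values of leafwise fields.
    have hext : ∀ w : E, (∀ c, Ω.bilin (φ 0 y) w (modelDeriv F E (φ 0) y c) = 0) →
        ∃ σ : S.LeafwiseVectorField, w = modelDeriv F E S.incl y (σ.field y) := by
      intro w hw
      rw [hφ.zero] at hw
      obtain ⟨a, rfl⟩ := S.exists_tangent_of_orthogonal y w hw
      obtain ⟨σ, hσ⟩ := S.exists_leafwiseVectorField_eq y ⟨a, (S.mem_nullSpace y a).2 hw⟩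
      exact ⟨σ, by rw [hσ]⟩
    obtain ⟨σ, hσ⟩ := hext (u 0) huv'.self_of_nhds.1
    obtain ⟨τ, hτ⟩ := hext (v 0) huv'.self_of_nhds.2
    have h1 := hφ.hasDerivAt_form hξ σ τ y hu hv hσ hτ huv'
    rw [h] at h1
    exact h1.congr_deriv neg_zero

end CoisotropicSubmanifold

/-! ### Existence of deformations with given normal velocity -/

section Push

variable {E : Type*} [NormedAddCommGroup E] [NormedSpace ℝ E]
  {X : Type*} [TopologicalSpace X] [ChartedSpace E X]
  {F : Type*} [NormedAddCommGroup F] [NormedSpace ℝ F]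
  {Y : Type*} [TopologicalSpace Y] [ChartedSpace F Y]

open Classical in
/-- Translate a family of maps `Y → X` in the chart around `x₀` with velocity `w`. -/
noncomputable def pushFamily (x₀ : X) (w : Y → E) (φ : ℝ → Y → X) (t : ℝ) (y : Y) : X :=
  if y ∈ tsupport w then
    (extChartAt 𝓘(ℝ, E) x₀).symm (extChartAt 𝓘(ℝ, E) x₀ (φ t y) + t • w y)
  else φ t y

/-- A family of maps starting at `i` and smooth near time zero. -/
structure IsGermFamily (i : Y → X) (φ : ℝ → Y → X) : Prop where
  zero : φ 0 = i
  smooth : ∀ y, ∀ᶠ p in 𝓝 ((0 : ℝ), y),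
    ContMDiffAt (𝓘(ℝ, ℝ).prod 𝓘(ℝ, F)) 𝓘(ℝ, E) ∞ (fun p : ℝ × Y => φ p.1 p.2) p

variable {i : Y → X} {φ : ℝ → Y → X} {x₀ : X} {w : Y → E}

theorem pushFamily_of_notMem {y : Y} (hy : y ∉ tsupport w) (t : ℝ) :
    pushFamily x₀ w φ t y = φ t y :=
  if_neg hy

/-- Off the support of `w` the displacement is zero, so the chart formula agrees with the other
branch wherever it makes sense. This removes the case distinction near boundary points of the
support. -/
theorem pushFamily_of_mem_source {t : ℝ} {y : Y}
    (hs : φ t y ∈ (extChartAt 𝓘(ℝ, E) x₀).source) :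
    pushFamily x₀ w φ t y =
      (extChartAt 𝓘(ℝ, E) x₀).symm (extChartAt 𝓘(ℝ, E) x₀ (φ t y) + t • w y) := by
  by_cases hy : y ∈ tsupport w
  · exact if_pos hy
  · rw [pushFamily_of_notMem hy, image_eq_zero_of_notMem_tsupport hy, smul_zero, add_zero,
      (extChartAt 𝓘(ℝ, E) x₀).left_inv hs]

theorem IsGermFamily.mdifferentiableAt_time (h : IsGermFamily (E := E) (F := F) i φ) (y : Y) :
    MDifferentiableAt 𝓘(ℝ, ℝ) 𝓘(ℝ, E) (fun t => φ t y) 0 :=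
  (ContMDiffAt.comp (0 : ℝ) (f := fun t : ℝ => (t, y)) (h.smooth y).self_of_nhds
    (contMDiffAt_id.prodMk contMDiffAt_const)).mdifferentiableAt (by simp)

variable [IsManifold 𝓘(ℝ, E) ∞ X]

/-- At a point of the support the chart formula holds on a whole neighbourhood for small time. The
complement of the support is open, and there the family is unchanged. -/
theorem IsGermFamily.push (h : IsGermFamily (E := E) (F := F) i φ)
    (hw : ContMDiff 𝓘(ℝ, F) 𝓘(ℝ, E) ∞ w)
    (hs : ∀ y ∈ tsupport w, i y ∈ (extChartAt 𝓘(ℝ, E) x₀).source) :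
    IsGermFamily (E := E) (F := F) i (pushFamily x₀ w φ) := by
  have hsrc : ∀ y ∈ tsupport w, φ 0 y ∈ (extChartAt 𝓘(ℝ, E) x₀).source := by
    rwa [h.zero]
  refine ⟨?_, fun y => ?_⟩
  · rw [← h.zero]
    funext y
    by_cases hy : y ∈ tsupport w
    · rw [pushFamily_of_mem_source (hsrc y hy), zero_smul, add_zero,
        (extChartAt 𝓘(ℝ, E) x₀).left_inv (hsrc y hy)]
    · exact pushFamily_of_notMem hy 0
  · by_cases hy : y ∈ tsupport w
    · have hcont : ContinuousAt (fun p : ℝ × Y => φ p.1 p.2) (0, y) :=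
        (h.smooth y).self_of_nhds.continuousAt
      have h1 : ∀ᶠ p in 𝓝 ((0 : ℝ), y), φ p.1 p.2 ∈ (extChartAt 𝓘(ℝ, E) x₀).source :=
        hcont.eventually_mem ((isOpen_extChartAt_source x₀).mem_nhds (hsrc y hy))
      have h2 : ContinuousAt (fun p : ℝ × Y => extChartAt 𝓘(ℝ, E) x₀ (φ p.1 p.2) + p.1 • w p.2)
          (0, y) := by
        have h3 := ContinuousAt.comp (f := fun p : ℝ × Y => φ p.1 p.2) (x := ((0 : ℝ), y))
          (continuousAt_extChartAt' (I := 𝓘(ℝ, E)) (hsrc y hy)) hcont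
        exact h3.add (continuousAt_fst.smul
          (ContinuousAt.comp (g := w) hw.continuous.continuousAt continuousAt_snd))
      have h4 : ∀ᶠ p in 𝓝 ((0 : ℝ), y), extChartAt 𝓘(ℝ, E) x₀ (φ p.1 p.2) + p.1 • w p.2 ∈
          (extChartAt 𝓘(ℝ, E) x₀).target := by
        refine h2.eventually_mem ((isOpen_extChartAt_target x₀).mem_nhds ?_)
        simpa using (extChartAt 𝓘(ℝ, E) x₀).map_source (hsrc y hy)
      filter_upwards [h.smooth y, h1, h4, h1.eventually_nhds] with p hp hps hpt hpe
      have h5 : ContMDiffAt (𝓘(ℝ, ℝ).prod 𝓘(ℝ, F)) 𝓘(ℝ, E) ∞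
          (fun p : ℝ × Y => extChartAt 𝓘(ℝ, E) x₀ (φ p.1 p.2)) p :=
        (contMDiffAt_extChartAt' (by simpa using hps)).comp p hp
      have h6 : ContMDiffAt (𝓘(ℝ, ℝ).prod 𝓘(ℝ, F)) 𝓘(ℝ, E) ∞
          (fun p : ℝ × Y => p.1 • w p.2) p :=
        contMDiffAt_fst.smul (hw.contMDiffAt.comp p contMDiffAt_snd)
      have h7 := ContMDiffAt.comp p (contMDiffAt_chart_symm hpt) (h5.add h6)
      exact h7.congr_of_eventuallyEq (hpe.mono fun q hq => pushFamily_of_mem_source hq)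
    · have h1 : ∀ᶠ p in 𝓝 ((0 : ℝ), y), p.2 ∉ tsupport w :=
        (continuous_snd.tendsto ((0 : ℝ), y)).eventually
          ((isClosed_tsupport w).isOpen_compl.mem_nhds hy)
      filter_upwards [h.smooth y, h1.eventually_nhds] with p hp hpe
      exact hp.congr_of_eventuallyEq (hpe.mono fun q hq => pushFamily_of_notMem hq _)

/-- Velocities add exactly: at time zero all families agree with `i`, so the inverse chart is
differentiated at the same point whatever translations came before. -/
theorem IsGermFamily.modelDeriv_push (h : IsGermFamily (E := E) (F := F) i φ)
    (hs : ∀ y ∈ tsupport w, i y ∈ (extChartAt 𝓘(ℝ, E) x₀).source) (y : Y) :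
    modelDeriv ℝ E (fun t => pushFamily x₀ w φ t y) 0 1 =
      modelDeriv ℝ E (fun t => φ t y) 0 1 +
        modelDeriv E E (extChartAt 𝓘(ℝ, E) x₀).symm (extChartAt 𝓘(ℝ, E) x₀ (i y)) (w y) := by
  by_cases hy : y ∈ tsupport w
  · have hsrc : φ 0 y ∈ (extChartAt 𝓘(ℝ, E) x₀).source := by
      rw [h.zero]
      exact hs y hy
    have hd := h.mdifferentiableAt_time y
    have heq : (fun t => pushFamily x₀ w φ t y) =ᶠ[𝓝 0] fun t =>
        (extChartAt 𝓘(ℝ, E) x₀).symm (extChartAt 𝓘(ℝ, E) x₀ (φ t y) + t • w y) := by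
      filter_upwards [hd.continuousAt.eventually_mem ((isOpen_extChartAt_source x₀).mem_nhds hsrc)]
        with t ht
      exact pushFamily_of_mem_source ht
    have h1 : DifferentiableAt ℝ (fun t => extChartAt 𝓘(ℝ, E) x₀ (φ t y)) 0 :=
      (MDifferentiableAt.comp (0 : ℝ) (mdifferentiableAt_chart hsrc) hd).differentiableAt
    have h2 : HasFDerivAt (fun t : ℝ => t • w y)
        ((ContinuousLinearMap.id ℝ ℝ).smulRight (w y)) 0 :=
      (hasFDerivAt_id (0 : ℝ)).smul_const (w y)
    have h3 : HasFDerivAt (fun t : ℝ => extChartAt 𝓘(ℝ, E) x₀ (φ t y) + t • w y)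
        (fderiv ℝ (fun t => extChartAt 𝓘(ℝ, E) x₀ (φ t y)) 0 +
          (ContinuousLinearMap.id ℝ ℝ).smulRight (w y)) 0 := h1.hasFDerivAt.add h2
    have ht : extChartAt 𝓘(ℝ, E) x₀ (φ 0 y) + (0 : ℝ) • w y ∈ (extChartAt 𝓘(ℝ, E) x₀).target := by
      simpa using (extChartAt 𝓘(ℝ, E) x₀).map_source hsrc
    have h4 := modelDeriv_comp (F := E) (E := E)
      (f := fun t : ℝ => extChartAt 𝓘(ℝ, E) x₀ (φ t y) + t • w y) (0 : ℝ)
      (mdifferentiableAt_chart_symm ht) h3.differentiableAt.mdifferentiableAt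
    rw [heq.modelDeriv_eq, h4, modelDeriv_eq_fderiv (F := ℝ) (E := E), h3.fderiv,
      ← modelDeriv_eq_fderiv (F := ℝ) (E := E)]
    simp only [ContinuousLinearMap.comp_apply, add_apply, map_add, zero_smul, add_zero]
    rw [modelDeriv_chart_symm_comp hd hsrc, h.zero]
    simp
  · have heq : (fun t => pushFamily x₀ w φ t y) = fun t => φ t y :=
      funext fun t => pushFamily_of_notMem hy t
    rw [heq, image_eq_zero_of_notMem_tsupport hy, map_zero, add_zero]

/-- Successive translations of a map `i` in the charts around `x n` with velocities `w n`. -/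
noncomputable def pushSeq (i : Y → X) (x : ℕ → X) (w : ℕ → Y → E) : ℕ → ℝ → Y → X
  | 0 => fun _ => i
  | n + 1 => pushFamily (x n) (w n) (pushSeq i x w n)

variable {x : ℕ → X} {w : ℕ → Y → E}

theorem isGermFamily_pushSeq (hi : ContMDiff 𝓘(ℝ, F) 𝓘(ℝ, E) ∞ i)
    (hw : ∀ n, ContMDiff 𝓘(ℝ, F) 𝓘(ℝ, E) ∞ (w n))
    (hs : ∀ n, ∀ y ∈ tsupport (w n), i y ∈ (extChartAt 𝓘(ℝ, E) (x n)).source) (n : ℕ) :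
    IsGermFamily (E := E) (F := F) i (pushSeq i x w n) := by
  induction n with
  | zero =>
    exact ⟨rfl, fun y => Eventually.of_forall fun p => hi.contMDiffAt.comp p contMDiffAt_snd⟩
  | succ n ih => exact ih.push (hw n) (hs n)

theorem modelDeriv_pushSeq (hi : ContMDiff 𝓘(ℝ, F) 𝓘(ℝ, E) ∞ i)
    (hw : ∀ n, ContMDiff 𝓘(ℝ, F) 𝓘(ℝ, E) ∞ (w n))
    (hs : ∀ n, ∀ y ∈ tsupport (w n), i y ∈ (extChartAt 𝓘(ℝ, E) (x n)).source) (n : ℕ) (y : Y) :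
    modelDeriv ℝ E (fun t => pushSeq i x w n t y) 0 1 = ∑ k ∈ Finset.range n,
      modelDeriv E E (extChartAt 𝓘(ℝ, E) (x k)).symm (extChartAt 𝓘(ℝ, E) (x k) (i y)) (w k y) := by
  induction n with
  | zero =>
    have h : modelDeriv ℝ E (fun _ : ℝ => i y) 0 = 0 := mfderiv_const
    change modelDeriv ℝ E (fun _ : ℝ => i y) 0 1 = _
    rw [h]
    rfl
  | succ n ih =>
    rw [Finset.sum_range_succ, ← ih]
    exact (isGermFamily_pushSeq hi hw hs n).modelDeriv_push (hs n) y

theorem pushSeq_eq {y : Y} {N : ℕ} (hN : ∀ n ≥ N, y ∉ tsupport (w n)) {n : ℕ} (hn : N ≤ n) (t : ℝ) :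
    pushSeq i x w n t y = pushSeq i x w N t y := by
  induction n, hn using Nat.le_induction with
  | base => rfl
  | succ n hn ih => exact (pushFamily_of_notMem (hN n hn) t).trans ih

/-- Locally finitely many successive translations converge to a smooth family of maps. -/
theorem exists_germFamily (hi : ContMDiff 𝓘(ℝ, F) 𝓘(ℝ, E) ∞ i)
    (hw : ∀ n, ContMDiff 𝓘(ℝ, F) 𝓘(ℝ, E) ∞ (w n))
    (hs : ∀ n, ∀ y ∈ tsupport (w n), i y ∈ (extChartAt 𝓘(ℝ, E) (x n)).source)
    (hfin : LocallyFinite fun n => tsupport (w n)) :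
    ∃ φ : ℝ → Y → X, IsGermFamily (E := E) (F := F) i φ ∧
      ∀ y, ∃ N, (∀ n ≥ N, y ∉ tsupport (w n)) ∧
        modelDeriv ℝ E (fun t => φ t y) 0 1 = ∑ k ∈ Finset.range N,
          modelDeriv E E (extChartAt 𝓘(ℝ, E) (x k)).symm
            (extChartAt 𝓘(ℝ, E) (x k) (i y)) (w k y) := by
  have hN : ∀ y : Y, ∃ N : ℕ, ∀ᶠ z in 𝓝 y, ∀ n ≥ N, z ∉ tsupport (w n) := by
    intro y
    obtain ⟨U, hU, hUf⟩ := hfin y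
    obtain ⟨N, hN⟩ := hUf.bddAbove
    refine ⟨N + 1, ?_⟩
    filter_upwards [hU] with z hz n hn hzn
    have := hN ⟨z, hzn, hz⟩
    omega
  choose N hN using hN
  have heq : ∀ y : Y, ∀ᶠ z in 𝓝 y, ∀ t, pushSeq i x w (N z) t z = pushSeq i x w (N y) t z := by
    intro y
    -- The two stopping indices are compared at their maximum, past which neither sequence changes.
    -- The limit family is therefore locally one fixed finite stage.
    filter_upwards [hN y] with z hz t
    rw [← pushSeq_eq (hN z).self_of_nhds (le_max_left (N z) (N y)),
      pushSeq_eq hz (le_max_right (N z) (N y))]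
  refine ⟨fun t y => pushSeq i x w (N y) t y, ⟨?_, fun y => ?_⟩, fun y => ⟨N y,
    (hN y).self_of_nhds, modelDeriv_pushSeq hi hw hs (N y) y⟩⟩
  · funext y
    exact congrFun (isGermFamily_pushSeq hi hw hs (N y)).zero y
  · have h1 : ∀ᶠ p in 𝓝 ((0 : ℝ), y), ∀ t,
        pushSeq i x w (N p.2) t p.2 = pushSeq i x w (N y) t p.2 :=
      (continuous_snd.tendsto ((0 : ℝ), y)).eventually (heq y)
    filter_upwards [(isGermFamily_pushSeq hi hw hs (N y)).smooth y, h1.eventually_nhds]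
      with p hp hpe
    exact hp.congr_of_eventuallyEq (hpe.mono fun q hq => hq q.1)

end Push

namespace CoisotropicSubmanifold

variable {E : Type*} [NormedAddCommGroup E] [NormedSpace ℝ E] [FiniteDimensional ℝ E]
  {X : Type*} [TopologicalSpace X] [ChartedSpace E X] {Ω : SymplecticForm E X}
  {F : Type*} [NormedAddCommGroup F] [NormedSpace ℝ F] [FiniteDimensional ℝ F]
  {Y : Type*} [TopologicalSpace Y] [ChartedSpace F Y]
  [IsManifold 𝓘(ℝ, F) ∞ Y] [IsManifold 𝓘(ℝ, E) ∞ X]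

/-- The open set is the interior of the set of points of smoothness. -/
theorem isDeformation_of_isGermFamily {S : CoisotropicSubmanifold Ω F Y} {φ : ℝ → Y → X}
    (h : IsGermFamily (E := E) (F := F) S.incl φ) : S.IsDeformation φ := by
  refine ⟨h.zero, interior {p | ContMDiffAt (𝓘(ℝ, ℝ).prod 𝓘(ℝ, F)) 𝓘(ℝ, E) ∞
    (fun p : ℝ × Y => φ p.1 p.2) p}, isOpen_interior, fun y => ?_, fun p hp => ?_⟩
  · exact mem_interior_iff_mem_nhds.2 (h.smooth y)
  · exact ContMDiffAt.contMDiffWithinAt (interior_subset hp)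

/-- Every leafwise `1`-form is the normal velocity of a deformation. -/
theorem exists_isDeformation_hasNormalVelocity [T2Space Y] [SigmaCompactSpace Y]
    (S : CoisotropicSubmanifold Ω F Y) (ξ : S.LeafwiseOneForm) :
    ∃ φ : ℝ → Y → X, S.IsDeformation φ ∧ S.HasNormalVelocity φ ξ := by
  -- Nonemptiness lets the countable cover be enumerated by `ℕ`, as the successive translations
  -- require.
  rcases isEmpty_or_nonempty Y with hY | hY
  · exact ⟨fun _ => S.incl, ⟨rfl, univ, isOpen_univ, fun y => hY.elim y, fun p => hY.elim p.2⟩,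
      fun y => hY.elim y⟩
  choose V hV hVn using fun y₀ => S.exists_local_normal_field ξ y₀
  choose U hU hUo hUm using fun y₀ => eventually_nhds_iff.1 (hVn y₀)
  obtain ⟨s, hsc, hsU⟩ := countable_cover_nhds_of_sigmaCompact
    fun y => (hUo y).mem_nhds (hUm y)
  have hsne : s.Nonempty := by
    obtain ⟨y⟩ := hY
    have : y ∈ ⋃ x ∈ s, U x := hsU ▸ mem_univ y
    obtain ⟨x, hx, -⟩ := mem_iUnion₂.1 this
    exact ⟨x, hx⟩
  obtain ⟨z, rfl⟩ := hsc.exists_eq_range hsne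
  obtain ⟨ρ, hρ⟩ := SmoothPartitionOfUnity.exists_isSubordinate 𝓘(ℝ, F) isClosed_univ
    (fun n => U (z n)) (fun n => hUo _) (by rw [← hsU, biUnion_range])
  set w : ℕ → Y → E := fun n y => ρ n y • V (z n) y with hw
  have hsupp : ∀ n, tsupport (w n) ⊆ tsupport (ρ n) := fun n => tsupport_smul_subset_left _ _
  obtain ⟨φ, hφ, hφv⟩ := exists_germFamily (x := fun n => S.incl (z n)) (w := w) S.contMDiff_incl
    (fun n => (ρ n).contMDiff.smul (hV (z n)))
    (fun n y hy => (hU (z n) y (hρ n (hsupp n hy))).1)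
    (ρ.locallyFinite.closure.subset hsupp)
  have hdef := isDeformation_of_isGermFamily hφ
  refine ⟨φ, hdef, fun y v => ?_⟩
  refine (Ω.bilin_apply (φ 0 y) (modelDeriv ℝ E (fun t => φ t y) 0 1)
    (modelDeriv F E (φ 0) y v.1)).symm.trans ?_
  rw [hdef.zero]
  obtain ⟨N, hN, hvel⟩ := hφv y
  rw [hvel, map_sum, sum_apply]
  have hterm : ∀ k, Ω.bilin (S.incl y) (modelDeriv E E (extChartAt 𝓘(ℝ, E) (S.incl (z k))).symm
      (extChartAt 𝓘(ℝ, E) (S.incl (z k)) (S.incl y)) (w k y)) (modelDeriv F E S.incl y v.1) =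
        ρ k y * ξ.1 y v := by
    intro k
    rw [hw]
    simp only [map_smul, smul_apply, smul_eq_mul]
    -- The normal field represents `ξ` only on `U (z k)`. This set contains every `y` with `ρ k y ≠
    -- 0`, and otherwise both sides vanish.
    by_cases hk : ρ k y = 0
    · rw [hk, zero_mul, zero_mul]
    · rw [(hU (z k) y (hρ k (subset_tsupport _ hk))).2 v]
  rw [Finset.sum_congr rfl fun k _ => hterm k, ← Finset.sum_mul]
  -- Past `N` only `w k y = 0` is known, and the field `V (z k)` could vanish where `ρ k` does not.
  -- A nonzero value of `ξ` rules this out through `hterm`, so the finite sum contains the whole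
  -- partition of unity.
  by_cases hξ : ξ.1 y v = 0
  · rw [hξ, mul_zero]
  have hsum : ∑ k ∈ Finset.range N, ρ k y = 1 := by
    have hzero : ∀ k, N ≤ k → ρ k y = 0 := by
      intro k hk
      have h := hterm k
      rw [image_eq_zero_of_notMem_tsupport (hN k hk)] at h
      simp only [map_zero, zero_apply] at h
      exact (mul_eq_zero.1 h.symm).resolve_right hξ
    rw [← finsum_eq_sum_of_support_subset, ρ.sum_eq_one (mem_univ y)]
    intro k hk
    rw [Finset.coe_range, mem_Iio]
    by_contra h
    exact hk (hzero k (not_lt.1 h))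
  rw [hsum, one_mul]

end CoisotropicSubmanifold

/-! ### Extension of functions from embedded submanifolds -/

section Extension

variable {E : Type*} [NormedAddCommGroup E] [NormedSpace ℝ E]
  {X : Type*} [TopologicalSpace X] [ChartedSpace E X] [IsManifold 𝓘(ℝ, E) ∞ X]
  {F : Type*} [NormedAddCommGroup F] [NormedSpace ℝ F]
  {Y : Type*} [TopologicalSpace Y] [ChartedSpace F Y] [IsManifold 𝓘(ℝ, F) ∞ Y] {f : Y → X}

open TopologicalSpace in
/-- A smooth function on an embedded submanifold extends to a neighbourhood. -/
theorem Manifold.IsSmoothEmbedding.exists_extension [FiniteDimensional ℝ E] [T2Space X]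
    [SigmaCompactSpace X] (hf : Manifold.IsSmoothEmbedding 𝓘(ℝ, F) 𝓘(ℝ, E) ∞ f)
    {g : Y → ℝ} (hg : ContMDiff 𝓘(ℝ, F) 𝓘(ℝ, ℝ) ∞ g) :
    ∃ (O : Set X) (h : X → ℝ), IsOpen O ∧ range f ⊆ O ∧
      ContMDiffOn 𝓘(ℝ, E) 𝓘(ℝ, ℝ) ∞ h O ∧ ∀ y, h (f y) = g y := by
  choose r hr using hf.exists_local_leftInverse
  choose U hU hUo hUm using fun y₀ => eventually_nhds_iff.1 (hr y₀)
  -- The image need not be closed in `X`, so the gluing takes place on an open neighbourhood covered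
  -- by domains of local left inverses.
  let O : Opens X := ⟨⋃ y, U y, isOpen_iUnion hUo⟩
  have : SecondCountableTopology X := ChartedSpace.secondCountable_of_sigmaCompact E X
  have : LocallyCompactSpace X := Manifold.locallyCompact_of_finiteDimensional 𝓘(ℝ, E)
  have : LocallyCompactSpace O := O.2.locallyCompactSpace
  -- The local extensions `g ∘ r y₀` are glued by a partition of unity. The set of admissible values
  -- at `x` is convex: the conditions fix the value at points of the image and are empty elsewhere.
  obtain ⟨k, hk⟩ := exists_contMDiffMap_forall_mem_convex_of_local (M := O) (F := ℝ) (n := ⊤)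
    𝓘(ℝ, E) (t := fun x => {c | ∀ y, f y = x → c = g y}) (fun x a ha b hb s t hs ht hst y hy => by
      rw [ha y hy, hb y hy, ← add_smul, hst, one_smul]) (fun x => by
      obtain ⟨y₀, hy₀⟩ := mem_iUnion.1 x.2
      refine ⟨Subtype.val ⁻¹' U y₀, ((hUo y₀).preimage continuous_subtype_val).mem_nhds hy₀,
        fun x => g (r y₀ x), fun x hx => ?_, fun x hx y hy => ?_⟩
      · have h1 : ContMDiffAt 𝓘(ℝ, E) 𝓘(ℝ, ℝ) ∞ (fun x => g (r y₀ x)) (x : X) :=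
          hg.contMDiffAt.comp _ (hU y₀ x hx).1
        exact (contMDiffAt_subtype_iff.2 h1).contMDiffWithinAt
      · exact congrArg g ((hU y₀ x hx).2 y hy))
  have hfO : ∀ y, f y ∈ O := fun y => mem_iUnion.2 ⟨y, hUm y⟩
  have hval : ∀ x : O, Function.extend Subtype.val k 0 (x : X) = k x :=
    fun x => Subtype.val_injective.extend_apply _ _ x
  refine ⟨O, Function.extend Subtype.val k 0, O.2, range_subset_iff.2 hfO, fun x hx => ?_,
    fun y => ?_⟩
  · have h1 : ContMDiffAt 𝓘(ℝ, E) 𝓘(ℝ, ℝ) ∞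
        (fun x : O => Function.extend Subtype.val k 0 (x : X)) ⟨x, hx⟩ := by
      rw [funext hval]
      exact k.contMDiff.contMDiffAt
    exact (contMDiffAt_subtype_iff.1 h1).contMDiffWithinAt
  · exact (hval ⟨f y, hfO y⟩).trans (hk ⟨f y, hfO y⟩ y rfl)

end Extension

/-! ### Infinitesimal Hamiltonian deformations -/

/-- Hamiltonian vectors: every covector is represented by the symplectic form. -/
theorem SymplecticForm.exists_bilin_eq {E : Type*} [NormedAddCommGroup E] [NormedSpace ℝ E]
    [FiniteDimensional ℝ E] {X : Type*} [TopologicalSpace X] [ChartedSpace E X]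
    (Ω : SymplecticForm E X) (x : X) (α : E →L[ℝ] ℝ) : ∃ z, Ω.bilin x z = α := by
  let L : E →ₗ[ℝ] Module.Dual ℝ E := (ContinuousLinearMap.coeLM ℝ) ∘ₗ (Ω.bilin x).toLinearMap
  have hL : Function.Injective L := (injective_iff_map_eq_zero L).2 fun u hu =>
    Ω.eq_zero_of_bilin_eq_zero x u fun w => congrArg (fun T : Module.Dual ℝ E => T w) hu
  obtain ⟨z, hz⟩ := (LinearMap.injective_iff_surjective_of_finrank_eq_finrank
    (Subspace.dual_finrank_eq (K := ℝ) (V := E)).symm).1 hL α.toLinearMap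
  exact ⟨z, ContinuousLinearMap.coe_injective hz⟩

namespace CoisotropicSubmanifold

variable {E : Type*} [NormedAddCommGroup E] [NormedSpace ℝ E]
  {X : Type*} [TopologicalSpace X] [ChartedSpace E X] {Ω : SymplecticForm E X}
  {F : Type*} [NormedAddCommGroup F] [NormedSpace ℝ F] [FiniteDimensional ℝ F]
  {Y : Type*} [TopologicalSpace Y] [ChartedSpace F Y]
  [IsManifold 𝓘(ℝ, F) ∞ Y] [IsManifold 𝓘(ℝ, E) ∞ X]

theorem d₀_apply (S : CoisotropicSubmanifold Ω F Y) (f : C^∞⟮𝓘(ℝ, F), Y; 𝓘(ℝ, ℝ), ℝ⟯) (y : Y)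
    (v : S.nullDistribution y) : (S.d₀ f).1 y v = modelDeriv F ℝ f y v.1 :=
  rfl

/-- The normal part of the Hamiltonian vector field of `h` is `d_𝓕 (h ∘ i)`, by the chain rule.
Conversely a Hamiltonian is obtained by extending `f` off `Y`. -/
theorem isInfinitesimalHamiltonian_iff [FiniteDimensional ℝ E] [T2Space X] [SigmaCompactSpace X]
    (S : CoisotropicSubmanifold Ω F Y) (ξ : S.LeafwiseOneForm) :
    S.IsInfinitesimalHamiltonian ξ ↔ ∃ f, S.d₀ f = ξ := by
  constructor
  · rintro ⟨O, h, Z, hO, hYO, hh, hZ, hξ⟩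
    have hat : ∀ y, ContMDiffAt 𝓘(ℝ, E) 𝓘(ℝ, ℝ) ∞ h (S.incl y) := fun y =>
      hh.contMDiffAt (hO.mem_nhds (hYO ⟨y, rfl⟩))
    refine ⟨⟨fun y => h (S.incl y), fun y => (hat y).comp y S.contMDiff_incl.contMDiffAt⟩, ?_⟩
    refine Subtype.ext (funext fun y => LinearMap.ext fun v => ?_)
    have h1 := modelDeriv_comp (F := E) (E := ℝ) y ((hat y).mdifferentiableAt (by simp))
      (S.mdifferentiableAt_incl y)
    refine (S.d₀_apply _ y v).trans ?_
    refine (congrArg (fun T : F →L[ℝ] ℝ => T v.1) h1).trans ?_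
    exact (hZ _ (hYO ⟨y, rfl⟩) _).symm.trans (hξ y v)
  · rintro ⟨f, rfl⟩
    obtain ⟨O, h, hO, hYO, hh, hhf⟩ := S.isSmoothEmbedding.exists_extension f.contMDiff
    -- The Hamiltonian vector is determined pointwise by nondegeneracy, so a pointwise choice
    -- suffices; its values outside `O` play no role.
    choose Z hZ using fun x => Ω.exists_bilin_eq x (modelDeriv E ℝ h x)
    have hZ' : ∀ (x : X) (w : E), Ω.form x ![(Z x : TangentSpace 𝓘(ℝ, E) x), w] =
        modelDeriv E ℝ h x w := fun x w =>
      (Ω.bilin_apply x (Z x) w).symm.trans (congrArg (fun T : E →L[ℝ] ℝ => T w) (hZ x))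
    refine ⟨O, h, Z, hO, hYO, hh, fun x _ w => hZ' x w, fun y v => ?_⟩
    have hat : MDifferentiableAt 𝓘(ℝ, E) 𝓘(ℝ, ℝ) h (S.incl y) :=
      (hh.contMDiffAt (hO.mem_nhds (hYO ⟨y, rfl⟩))).mdifferentiableAt (by simp)
    have h1 := modelDeriv_comp (F := E) (E := ℝ) y hat (S.mdifferentiableAt_incl y)
    rw [funext hhf] at h1
    exact (hZ' _ _).trans (congrArg (fun T : F →L[ℝ] ℝ => T v.1) h1).symm

end CoisotropicSubmanifold

/-! ### The main theorem: assembly of the four statements. -/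

theorem mainTheorem8
    {E : Type*} [NormedAddCommGroup E] [NormedSpace ℝ E] [FiniteDimensional ℝ E]
    {X : Type*} [TopologicalSpace X] [ChartedSpace E X] [IsManifold 𝓘(ℝ, E) ∞ X]
    [T2Space X] [SigmaCompactSpace X]
    {F : Type*} [NormedAddCommGroup F] [NormedSpace ℝ F] [FiniteDimensional ℝ F]
    {Y : Type*} [TopologicalSpace Y] [ChartedSpace F Y] [IsManifold 𝓘(ℝ, F) ∞ Y]
    (Ω : SymplecticForm E X) (S : CoisotropicSubmanifold Ω F Y) :
    (∀ ξ : S.LeafwiseOneForm, S.IsInfinitesimalDeformation ξ ↔ S.d₁ ξ = 0) ∧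
    (∀ (ξ : S.LeafwiseOneForm) (φ : ℝ → Y → X), S.IsDeformation φ → S.HasNormalVelocity φ ξ →
      (CoisotropicSubmanifold.IsCoisotropicToFirstOrder (F := F) Ω φ ↔ S.d₁ ξ = 0)) ∧
    (∀ ξ : S.LeafwiseOneForm, S.IsInfinitesimalHamiltonian ξ ↔ ∃ f, S.d₀ f = ξ) ∧
    ∃ D T : Submodule ℝ S.LeafwiseOneForm,
      (∀ ξ, ξ ∈ D ↔ S.IsInfinitesimalDeformation ξ) ∧
      (∀ ξ, ξ ∈ T ↔ S.IsInfinitesimalHamiltonian ξ) ∧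
      T ≤ D ∧
      ∃ e : (D ⧸ T.submoduleOf D) ≃ₗ[ℝ] S.H1,
        ∀ (ξ : S.LeafwiseOneForm) (hD : ξ ∈ D) (hd : ξ ∈ LinearMap.ker S.d₁),
          e (Submodule.Quotient.mk ⟨ξ, hD⟩) = Submodule.Quotient.mk ⟨ξ, hd⟩ := by
  have hemb := S.isSmoothEmbedding.isEmbedding
  have : SecondCountableTopology X := ChartedSpace.secondCountable_of_sigmaCompact E X
  -- `Y` inherits the Hausdorff property and second countability from `X`. With local compactness
  -- this gives the σ-compactness required by the partition of unity on `Y`.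
  have : T2Space Y := hemb.t2Space
  have : SecondCountableTopology Y := hemb.secondCountableTopology
  have : LocallyCompactSpace Y := Manifold.locallyCompact_of_finiteDimensional 𝓘(ℝ, F)
  have hdef : ∀ ξ : S.LeafwiseOneForm, S.IsInfinitesimalDeformation ξ ↔ S.d₁ ξ = 0 := by
    intro ξ
    constructor
    · rintro ⟨φ, hφ, hξ, hc⟩
      exact (hφ.isCoisotropicToFirstOrder_iff hξ).1 hc
    · intro h
      obtain ⟨φ, hφ, hξ⟩ := S.exists_isDeformation_hasNormalVelocity ξ
      exact ⟨φ, hφ, hξ, (hφ.isCoisotropicToFirstOrder_iff hξ).2 h⟩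
  -- With `D = ker d₁` and `T = im d₀` the quotient `D / T` is literally `H1`, so the isomorphism is
  -- the identity. The remaining inclusion `T ≤ D` is `d_𝓕 ∘ d_𝓕 = 0`.
  refine ⟨hdef, fun ξ φ hφ hξ => hφ.isCoisotropicToFirstOrder_iff hξ,
    S.isInfinitesimalHamiltonian_iff, LinearMap.ker S.d₁, LinearMap.range S.d₀,
    fun ξ => (hdef ξ).symm, fun ξ => (S.isInfinitesimalHamiltonian_iff ξ).symm, ?_,
    LinearEquiv.refl ℝ _, fun ξ _ _ => rfl⟩
  rintro _ ⟨f, rfl⟩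
  exact S.d₁_d₀ f
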